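/- For a finite group $G$ let $\mathrm{Irr}(G)$ be the set of isomorphism classes of irreducible complex representations of $G$. The Plancherel measure of $G$ is the probability measure on $\mathrm{Irr}(G)$ that chooses $\lambda$ with probability $\dim(\lambda)^2/|G|$. Write $\chi^\lambda$ for the character of $\lambda$. Theorem. Let $i\ge 2$ be an integer. There is a constant $A_i$, depending only on $i$, such that the following holds for every integer $n\ge i$. Let $C$ be the conjugacy class of $i$-cycles in the symmetric group $S_n$, let $\lambda\in\mathrm{Irr}(S_n)$ be chosen from the Plancherel measure of $S_n$, and let \[ W=\frac{\sqrt{\binom{n}{i}(i-1)!}\;\chi^{\lambda}(C)}{\dim(\lambda)}, \] where $\chi^\lambda(C)$ is the (real) value of $\chi^\lambda$ on any element of $C$. Then for all real $x_0$, \[ \left|\mathbb{P}(W\le x_0)-\frac{1}{\sqrt{2\pi}}\int_{-\infty}^{x_0}e^{-x^2/2}\,dx\right|\le A_i\,n^{-1/4}. \] -/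

import Mathlib

open CategoryTheory MeasureTheory

noncomputable section

/-- The isomorphism relation on the irreducible finite-dimensional complex representations of
`G`. -/
def irrepSetoid (G : Type) [Group G] : Setoid {V : FDRep ℂ G // Simple V} where
  r V W := Nonempty (V.1 ≅ W.1)
  iseqv :=
    { refl := fun V => ⟨Iso.refl V.1⟩
      symm := fun ⟨f⟩ => ⟨f.symm⟩
      trans := fun ⟨f⟩ ⟨g⟩ => ⟨f.trans g⟩ }

/-- `Irr G`: the isomorphism classes of irreducible finite-dimensional complex representations
of `G`. -/
def Irr (G : Type) [Group G] : Type 1 :=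
  Quotient (irrepSetoid G)

namespace Irr

variable {G : Type} [Group G]

/-- The character of (any representative of) a class of irreducible representations. -/
def character (l : Irr G) : G → ℂ :=
  Quotient.lift (s := irrepSetoid G) (fun V => V.1.character)
    (fun _ _ ⟨f⟩ => FDRep.char_iso f) l

/-- The dimension of (any representative of) a class of irreducible representations. -/
def dim (l : Irr G) : ℕ :=
  Quotient.lift (s := irrepSetoid G) (fun V => Module.finrank ℂ V.1)
    (fun _ _ ⟨f⟩ => LinearEquiv.finrank_eq (FDRep.isoToLinearEquiv f)) l

/-- Every set of irreducible representations is an event. -/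
instance : MeasurableSpace (Irr G) := ⊤

/-- The Plancherel measure of a finite group: each `l` is chosen with probability
`dim(l)² / |G|`. -/
def plancherel (G : Type) [Group G] [Finite G] : Measure (Irr G) :=
  Measure.sum fun l : Irr G =>
    ((l.dim : ENNReal) ^ 2 / (Nat.card G : ENNReal)) • Measure.dirac l

/-- The normalized character ratio `√(C(n,i) (i-1)!) χ^l(c) / dim(l)`, where `c` is an `i`-cycle
in `S_n`. Characters of symmetric groups are real-valued, so that taking the real part of
`χ^l(c)` only changes its type. -/
def cycleRatio {n : ℕ} (i : ℕ) (c : Equiv.Perm (Fin n)) (l : Irr (Equiv.Perm (Fin n))) : ℝ :=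
  Real.sqrt ((n.choose i : ℝ) * ((i - 1).factorial : ℝ)) * (l.character c).re / (l.dim : ℝ)

end Irr

end

/-! The proof is Stein's method of exchangeable pairs, with every moment computed in the group
algebra. A symmetric class function `f` acts on each irreducible `l` by a real scalar `hat f l`.
Convolution becomes multiplication of these scalars, and the Plancherel mean of `hat f` is `f 1`, so
Plancherel expectations turn into finite sums over `S_n`. The statistic W is the scalar of the class
sum of C divided by `√|C|`.

The pair (W, W') comes from the joint law `kernel θ` on pairs of irreducibles, where θ is the
proportion of fixed points. It is symmetric with Plancherel marginals. It is nonnegative because θ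
is an average of indicators of point stabilizers. Averaging `hat f` against it replaces `f` by `θ f`
(`sum_kernel_mul_hat`). As θ equals 1 - i/n on C, E[W' | l] = (1 - a) W with a = i/n.

W² is the scalar of N/|C|, where N(g) counts factorizations of g into two i-cycles. The variance of
E[(W' - W)² | l] and the fourth moment of W' - W are therefore sums over g of weighted N(g)². Their
leading terms, from g = 1 and from products of disjoint cycles, cancel or are controlled by
cancellation. What remains counts solutions of ab = cd with a, b overlapping and ab ≠ 1; these move
at most 2i - 1 points (`card_union_lt_of_mem_quads`), so there are O(n^(2i-1)) of them, against |C|²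
of order n^(2i).

Stein's bound then gives an error O((1 + K) n^(-1/2)) for K-Lipschitz test functions. Replacing an
indicator by a ramp of width δ means K = 1/δ and costs another δ; the choice δ = n^(-1/4) balances
the two. -/

open CategoryTheory MeasureTheory

noncomputable section

namespace Irr

open Representation Finset

/-! ### Irreducible characters: Schur's lemma, orthogonality, finiteness of `Irr G`. -/

section Character

variable {G : Type} [Group G]

/-- The class of a simple representation. -/
def mk (V : FDRep ℂ G) (hV : Simple V) : Irr G :=
  Quotient.mk (irrepSetoid G) ⟨V, hV⟩

lemma exists_mk (l : Irr G) : ∃ V : FDRep ℂ G, ∃ hV : Simple V, l = mk V hV := by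
  induction l using Quotient.inductionOn with
  | h V => exact ⟨V.1, V.2, rfl⟩

lemma character_mk (V : FDRep ℂ G) (hV : Simple V) : (mk V hV).character = V.character := rfl

lemma dim_mk (V : FDRep ℂ G) (hV : Simple V) : (mk V hV).dim = Module.finrank ℂ V := rfl

lemma mk_eq_mk_iff {V W : FDRep ℂ G} {hV : Simple V} {hW : Simple W} :
    mk V hV = mk W hW ↔ Nonempty (V ≅ W) :=
  Quotient.eq (r := irrepSetoid G)

lemma character_one (l : Irr G) : l.character 1 = l.dim := by
  obtain ⟨V, hV, rfl⟩ := l.exists_mk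
  simp [character_mk, dim_mk]

lemma character_mul_comm (l : Irr G) (g h : G) : l.character (g * h) = l.character (h * g) := by
  obtain ⟨V, hV, rfl⟩ := l.exists_mk
  simp only [character_mk]
  exact V.char_mul_comm _ _

lemma character_conj (l : Irr G) (g h : G) : l.character (h * g * h⁻¹) = l.character g := by
  obtain ⟨V, hV, rfl⟩ := l.exists_mk
  simp only [character_mk, FDRep.char_conj]

lemma dim_pos (l : Irr G) : 0 < l.dim := by
  obtain ⟨V, hV, rfl⟩ := l.exists_mk
  rw [dim_mk, Nat.pos_iff_ne_zero]
  intro h0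
  have hs : Subsingleton V := Module.finrank_zero_iff.mp h0
  refine id_nonzero V ?_
  ext v
  exact Subsingleton.elim (α := V) _ _

variable [Fintype G]

lemma char_orthonormal [DecidableEq (Irr G)] (l m : Irr G) :
    ∑ g : G, l.character g * m.character g⁻¹ = if l = m then (Nat.card G : ℂ) else 0 := by
  obtain ⟨V, hV, rfl⟩ := l.exists_mk
  obtain ⟨W, hW, rfl⟩ := m.exists_mk
  have hc : (Nat.card G : ℂ) ≠ 0 := by exact_mod_cast Nat.card_pos.ne'
  have := invertibleOfNonzero hc
  classical
  have h := FDRep.char_orthonormal V W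
  rw [inv_mul_eq_iff_eq_mul₀ hc] at h
  rw [character_mk, character_mk, h, mul_ite, mul_one, mul_zero]
  exact if_congr mk_eq_mk_iff.symm rfl rfl

omit [Fintype G] in
/-- Schur's lemma: an equivariant endomorphism of a simple representation is a scalar. -/
lemma exists_eq_smul_id_of_commute (V : FDRep ℂ G) [Simple V] (T : V →ₗ[ℂ] V)
    (hT : ∀ g, T ∘ₗ V.ρ g = V.ρ g ∘ₗ T) : ∃ c : ℂ, T = c • LinearMap.id := by
  let f : V ⟶ V := ⟨FGModuleCat.ofHom T, fun g => by
    ext v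
    exact LinearMap.congr_fun (hT g) v⟩
  obtain ⟨c, hc⟩ := endomorphism_simple_eq_smul_id ℂ f
  refine ⟨c, ?_⟩
  ext v
  have := congrArg (fun q : V ⟶ V => q.hom.hom.hom v) hc
  exact this.symm

/-- The sum of all conjugates of `h` is central, hence a scalar by Schur; its trace identifies the
scalar. -/
lemma character_mul_character (l : Irr G) (g h : G) :
    (Nat.card G : ℂ) * (l.character g * l.character h) =
      l.dim * ∑ k : G, l.character (g * (k * h * k⁻¹)) := by
  obtain ⟨V, hV, rfl⟩ := l.exists_mk
  obtain ⟨c, hc⟩ := exists_eq_smul_id_of_commute V (∑ k : G, V.ρ (k * h * k⁻¹)) (by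
    intro x
    change (∑ k : G, V.ρ (k * h * k⁻¹)) * V.ρ x = V.ρ x * ∑ k : G, V.ρ (k * h * k⁻¹)
    simp only [Finset.sum_mul, Finset.mul_sum, ← map_mul]
    refine Fintype.sum_equiv (Equiv.mulLeft x⁻¹) _ _ fun k => ?_
    congr 1
    simp [mul_assoc])
  have h1 : (Nat.card G : ℂ) * V.character h = c * Module.finrank ℂ V := by
    have := congrArg (LinearMap.trace ℂ V) hc
    rw [map_sum] at this
    have h2 : ∀ k : G, LinearMap.trace ℂ V (V.ρ (k * h * k⁻¹)) = V.character h := fun k =>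
      V.char_conj h k
    simpa only [h2, map_smul, Finset.sum_const, Finset.card_univ, nsmul_eq_mul, smul_eq_mul,
      LinearMap.trace_id, ← Nat.card_eq_fintype_card] using this
  have h2 : ∑ k : G, V.character (g * (k * h * k⁻¹)) = c * V.character g := by
    have := congrArg (fun T => LinearMap.trace ℂ V (V.ρ g * T)) hc
    simp only [Finset.mul_sum, map_sum, ← map_mul] at this
    rw [FDRep.character, ← smul_eq_mul, ← map_smul]
    refine this.trans ?_
    congr 1
    ext v
    simp
  simp only [character_mk, dim_mk]
  rw [h2, mul_left_comm, h1]
  ring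

lemma linearIndependent_character :
    LinearIndependent ℂ (fun l : Irr G => l.character) := by
  classical
  rw [linearIndependent_iff']
  intro s c hc m hm
  have h := congrArg (fun f : G → ℂ => ∑ g, f g * m.character g⁻¹) hc
  simp only [Finset.sum_apply, Pi.smul_apply, smul_eq_mul, Finset.sum_mul, mul_assoc,
    Pi.zero_apply, zero_mul, Finset.sum_const_zero] at h
  rw [Finset.sum_comm] at h
  simp only [← Finset.mul_sum, char_orthonormal] at h
  simp [hm] at h
  exact h

instance [Finite G] : Finite (Irr G) := by
  have := Fintype.ofFinite G
  exact (linearIndependent_character (G := G)).finite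

instance : Fintype (Irr G) := Fintype.ofFinite _

end Character

/-! ### Decomposition of the regular character. -/

section Decomposition

variable {G : Type} [Group G] [Fintype G]

omit [Fintype G] in
lemma character_eq_add_of_isCompl {V : Type} [AddCommGroup V] [Module ℂ V] [FiniteDimensional ℂ V]
    (ρ : Representation ℂ G V) {U U' : Subrepresentation ρ}
    (h : IsCompl U.toSubmodule U'.toSubmodule) :
    ρ.character = U.toRepresentation.character + U'.toRepresentation.character := by
  ext g
  have hi : DirectSum.IsInternal (fun b : Bool => cond b U.toSubmodule U'.toSubmodule) := by
    rw [DirectSum.isInternal_submodule_iff_isCompl (i := true) (j := false) _ (by decide)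
      (by ext b; cases b <;> simp)]
    exact h
  have ht := LinearMap.trace_eq_sum_trace_restrict hi (f := ρ g) (by
    rintro (_ | _) v hv
    · exact U'.apply_mem_toSubmodule g hv
    · exact U.apply_mem_toSubmodule g hv)
  rw [Fintype.sum_bool] at ht
  exact ht

/-- Every character of a finite group is a combination of irreducible characters. -/
lemma character_mem_span (d : ℕ) : ∀ {V : Type} [AddCommGroup V] [Module ℂ V]
    [FiniteDimensional ℂ V] (ρ : Representation ℂ G V), Module.finrank ℂ V = d →
    ρ.character ∈ Submodule.span ℂ (Set.range fun l : Irr G => l.character) := by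
  induction d using Nat.strong_induction_on with
  | _ d ih =>
  intro V _ _ _ ρ hd
  have hc : (Nat.card G : ℂ) ≠ 0 := by exact_mod_cast Nat.card_pos.ne'
  have := invertibleOfNonzero hc
  by_cases hirr : IsIrreducible ρ
  -- Irreducibility passes to the categorical notion `Simple` through the criterion that the
  -- character has norm one.
  · have hs : Simple (FDRep.of ρ) := by
      rw [FDRep.simple_iff_char_is_norm_one]
      have h := Representation.char_orthonormal ρ ρ
      rw [if_pos ⟨Representation.Equiv.refl ρ⟩, inv_mul_eq_iff_eq_mul₀ hc, mul_one] at h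
      exact h
    exact Submodule.subset_span ⟨mk _ hs, rfl⟩
  rcases subsingleton_or_nontrivial V with hV | hV
  · have : ρ.character = 0 := by
      ext g
      have : ρ g = 0 := Subsingleton.elim _ _
      simp [Representation.character, this]
    rw [this]
    exact Submodule.zero_mem _
  have : Nontrivial (Subrepresentation ρ) := by
    refine ⟨⊥, ⊤, fun h => ?_⟩
    have h' : (⊥ : Submodule ℂ V) = ⊤ := congrArg Subrepresentation.toSubmodule h
    exact bot_ne_top h'
  obtain ⟨U, hU0, hU1⟩ : ∃ U : Subrepresentation ρ, U ≠ ⊥ ∧ U ≠ ⊤ := by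
    by_contra! hcon
    exact hirr ⟨fun U => or_iff_not_imp_left.2 (hcon U)⟩
  have : NeZero (Nat.card G : ℂ) := ⟨hc⟩
  have : IsSemisimpleRepresentation ρ :=
    (isSemisimpleRepresentation_iff_isSemisimpleModule_asModule ρ).2 inferInstance
  obtain ⟨U', hU'⟩ := exists_isCompl U
  have hcompl : IsCompl U.toSubmodule U'.toSubmodule := by
    constructor
    · rw [disjoint_iff, ← Subrepresentation.toSubmodule_inf, disjoint_iff.1 hU'.1]
      rfl
    · rw [codisjoint_iff, ← Subrepresentation.toSubmodule_sup, codisjoint_iff.1 hU'.2]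
      rfl
  have hsum := Submodule.finrank_add_eq_of_isCompl hcompl
  have hU0' : U.toSubmodule ≠ ⊥ := fun h => hU0 (Subrepresentation.toSubmodule_injective h)
  have hU1' : U.toSubmodule ≠ ⊤ := fun h => hU1 (Subrepresentation.toSubmodule_injective h)
  have h0 := Submodule.one_le_finrank_iff.2 hU0'
  have h1 := Submodule.finrank_lt hU1'
  rw [character_eq_add_of_isCompl ρ hcompl]
  exact Submodule.add_mem _ (ih _ (by omega) _ rfl) (ih _ (by omega) _ rfl)

/-- The decomposition of the regular character. -/
lemma sum_dim_mul_character [DecidableEq G] (g : G) :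
    ∑ l : Irr G, (l.dim : ℂ) * l.character g = if g = 1 then (Nat.card G : ℂ) else 0 := by
  classical
  have key := character_mem_span _ (Representation.leftRegular ℂ G) rfl
  have hreg : ∀ g, (Representation.leftRegular ℂ G).character g
      = if g = 1 then (Nat.card G : ℂ) else 0 := by
    intro g
    rw [Representation.character, LinearMap.trace_eq_matrix_trace ℂ
      (Module.Basis.ofRepr (MonoidAlgebra.coeffLinearEquiv ℂ : MonoidAlgebra ℂ G ≃ₗ[ℂ] G →₀ ℂ)), Matrix.trace]
    simp [LinearMap.toMatrix_apply, Finsupp.single_apply]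
  obtain ⟨c, hc⟩ := (Submodule.mem_span_range_iff_exists_fun ℂ).1 key
  have hcm : ∀ m : Irr G, c m = m.dim := by
    intro m
    have h := congrArg (fun f : G → ℂ => ∑ g, f g * m.character g⁻¹) hc
    simp only [Finset.sum_apply, Pi.smul_apply, smul_eq_mul, Finset.sum_mul, mul_assoc,
      hreg] at h
    rw [Finset.sum_comm] at h
    simp only [← Finset.mul_sum, char_orthonormal] at h
    simpa [character_one, mul_comm (c m)] using h
  rw [← hreg, ← hc]
  simp [hcm]

end Decomposition

/-! ### Integrality of restricted scalar products, and reality of central scalars. -/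

section Positivity

variable {G : Type} [Group G]

/-- The restrictions of two characters to a subgroup have nonnegative scalar product. -/
lemma sum_subgroup_character_mul_character (l m : Irr G) (H : Subgroup G) [Fintype H] :
    ∃ d : ℕ, ∑ h : H, l.character h * m.character (h⁻¹ : G) = (Nat.card H : ℂ) * d := by
  obtain ⟨V, hV, rfl⟩ := l.exists_mk
  obtain ⟨W, hW, rfl⟩ := m.exists_mk
  have hc : (Nat.card H : ℂ) ≠ 0 := by exact_mod_cast Nat.card_pos.ne'
  have := invertibleOfNonzero hc
  have h := FDRep.scalar_product_char_eq_finrank_equivariant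
    (FDRep.of (W.ρ.comp H.subtype)) (FDRep.of (V.ρ.comp H.subtype))
  rw [inv_mul_eq_iff_eq_mul₀ hc] at h
  exact ⟨_, h⟩

open ComplexConjugate in
/-- A class function invariant under inversion with real values acts on an irreducible
representation by a real scalar. -/
lemma conj_sum_mul_character [Fintype G] (l : Irr G) (f : G → ℝ)
    (hf : ∀ g h, f (h * g * h⁻¹) = f g) (hf' : ∀ g, f g⁻¹ = f g) :
    conj (∑ g, (f g : ℂ) * l.character g) = ∑ g, (f g : ℂ) * l.character g := by
  set z := ∑ g, (f g : ℂ) * l.character g with hz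
  have hd : (l.dim : ℂ) ≠ 0 := by exact_mod_cast l.dim_pos.ne'
  have hG : (Nat.card G : ℂ) ≠ 0 := by exact_mod_cast Nat.card_pos.ne'
  have heig : ∀ x, (l.dim : ℂ) * ∑ g, (f g : ℂ) * l.character (g * x) = z * l.character x := by
    intro x
    have h1 : (Nat.card G : ℂ) * (z * l.character x) =
        ∑ g, ∑ k, (l.dim : ℂ) * ((f g : ℂ) * l.character (x * (k * g * k⁻¹))) := by
      rw [hz, Finset.sum_mul, Finset.mul_sum]
      refine Finset.sum_congr rfl fun g _ => ?_
      have := l.character_mul_character x g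
      simp only [mul_left_comm (l.dim : ℂ), ← Finset.mul_sum]
      rw [← this]
      ring
    rw [Finset.sum_comm] at h1
    have h2 : ∀ k, ∑ g, (l.dim : ℂ) * ((f g : ℂ) * l.character (x * (k * g * k⁻¹))) =
        (l.dim : ℂ) * ∑ g, (f g : ℂ) * l.character (g * x) := by
      intro k
      rw [Finset.mul_sum]
      refine Fintype.sum_equiv (MulAut.conj k).toEquiv _ _ fun g => ?_
      simp [hf, l.character_mul_comm x]
    simp only [h2, Finset.sum_const, Finset.card_univ, nsmul_eq_mul,
      ← Nat.card_eq_fintype_card] at h1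
    exact (mul_left_cancel₀ hG h1).symm
  -- By `heig`, the character is an eigenvector of convolution by `f` with eigenvalue `z / dim`.
  -- That operator is self-adjoint since `f` is real and inversion-invariant, so pairing with the
  -- character both ways gives `z = conj z`; nonvanishing of the norm allows the cancellation.
  have hpos : ∑ x, l.character x * conj (l.character x) ≠ 0 := by
    simp only [Complex.mul_conj, ← Complex.ofReal_sum]
    rw [Ne, Complex.ofReal_eq_zero]
    refine (Finset.sum_pos' (fun _ _ => Complex.normSq_nonneg _) ⟨1, Finset.mem_univ _, ?_⟩).ne'
    rw [Complex.normSq_pos, character_one]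
    exact hd
  have h1 : z * ∑ x, l.character x * conj (l.character x) =
      ∑ g, ∑ x, (l.dim : ℂ) * (f g) * (l.character (g * x) * conj (l.character x)) := by
    rw [Finset.sum_comm, Finset.mul_sum]
    refine Finset.sum_congr rfl fun x _ => ?_
    rw [← mul_assoc, ← heig, Finset.mul_sum, Finset.sum_mul]
    exact Finset.sum_congr rfl fun g _ => by ring
  have h2 : conj z * ∑ x, l.character x * conj (l.character x) =
      ∑ g, ∑ x, (l.dim : ℂ) * (f g) * (l.character x * conj (l.character (g * x))) := by
    rw [Finset.sum_comm, Finset.mul_sum]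
    refine Finset.sum_congr rfl fun x _ => ?_
    rw [mul_left_comm, ← map_mul, ← heig, map_mul, map_sum, Finset.mul_sum, Finset.mul_sum]
    refine Finset.sum_congr rfl fun g _ => ?_
    simp only [map_mul, Complex.conj_ofReal, map_natCast]
    ring
  refine mul_right_cancel₀ hpos (h2.trans (Eq.trans ?_ h1.symm))
  refine Fintype.sum_equiv (Equiv.inv G) _ _ fun g => ?_
  refine Fintype.sum_equiv (Equiv.mulLeft g) _ _ fun x => ?_
  simp [hf']

end Positivity

end Irr

/-! ### Symmetric class functions and their convolution. -/

/-- A real class function invariant under inversion. -/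
structure IsSymmClass {G : Type} [Group G] (f : G → ℝ) : Prop where
  conj : ∀ g h, f (h * g * h⁻¹) = f g
  inv : ∀ g, f g⁻¹ = f g

namespace IsSymmClass

variable {G : Type} [Group G] {f h : G → ℝ}

lemma mul (hf : IsSymmClass f) (hh : IsSymmClass h) : IsSymmClass fun g => f g * h g :=
  ⟨fun g k => by rw [hf.conj, hh.conj], fun g => by rw [hf.inv, hh.inv]⟩

lemma mul_comm (hf : IsSymmClass f) (g k : G) : f (g * k) = f (k * g) := by
  rw [← hf.conj (g * k) k]
  congr 1
  group

lemma of_isConj (h : ∀ g k : G, IsConj g k → f g = f k) (hG : ∀ g : G, IsConj g g⁻¹) :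
    IsSymmClass f :=
  ⟨fun _ k => (h _ _ (isConj_iff.2 ⟨k, rfl⟩)).symm, fun g => (h _ _ (hG g)).symm⟩

end IsSymmClass

/-- Convolution of functions on a finite group. -/
def groupConv {G : Type} [Group G] [Fintype G] (f h : G → ℝ) (g : G) : ℝ :=
  ∑ x, f x * h (x⁻¹ * g)

lemma IsSymmClass.groupConv {G : Type} [Group G] [Fintype G] {f h : G → ℝ}
    (hf : IsSymmClass f) (hh : IsSymmClass h) : IsSymmClass (groupConv f h) := by
  refine ⟨fun g k => ?_, fun g => ?_⟩
  · refine Fintype.sum_equiv (MulAut.conj k⁻¹).toEquiv _ _ fun x => ?_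
    congr 1
    · simpa using (hf.conj x k⁻¹).symm
    · rw [← hh.conj _ k⁻¹]
      congr 1
      simp
      group
  · refine Fintype.sum_equiv (Equiv.inv G) _ _ fun x => ?_
    simp only [Equiv.inv_apply, hf.inv, inv_inv]
    rw [← hh.inv, mul_inv_rev, inv_inv, inv_inv, hh.mul_comm]

namespace Irr

/-! ### Fourier analysis of class functions under the Plancherel measure, and the reversible kernel.
-/

section Fourier

variable {G : Type} [Group G] [Fintype G]

/-- The scalar by which the element `∑ f(g) g` of the group algebra acts on an irreducible
representation, for a symmetric class function `f`. -/
def hat (f : G → ℝ) (l : Irr G) : ℝ :=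
  (∑ g, (f g : ℂ) * l.character g).re / l.dim

lemma dim_mul_hat {f : G → ℝ} (hf : IsSymmClass f) (l : Irr G) :
    (l.dim : ℂ) * (hat f l : ℂ) = ∑ g, (f g : ℂ) * l.character g := by
  have hd : (l.dim : ℂ) ≠ 0 := by exact_mod_cast l.dim_pos.ne'
  have h := Complex.conj_eq_iff_re.1 (l.conj_sum_mul_character f hf.conj hf.inv)
  rw [hat, Complex.ofReal_div, h, Complex.ofReal_natCast, mul_div_cancel₀ _ hd]

lemma character_mul_dim_mul_hat {f : G → ℝ} (hf : IsSymmClass f) (l : Irr G) (g : G) :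
    l.character g * hat f l = ∑ k, (f k : ℂ) * l.character (g * k) := by
  have hd : (l.dim : ℂ) ≠ 0 := by exact_mod_cast l.dim_pos.ne'
  have hG : (Nat.card G : ℂ) ≠ 0 := by exact_mod_cast Nat.card_pos.ne'
  refine mul_left_cancel₀ (mul_ne_zero hG hd) ?_
  have h1 : (Nat.card G : ℂ) * l.dim * (l.character g * hat f l) =
      ∑ k, ∑ x, (l.dim : ℂ) * ((f k : ℂ) * l.character (g * (x * k * x⁻¹))) := by
    rw [mul_assoc, mul_left_comm (l.dim : ℂ), dim_mul_hat hf, Finset.mul_sum, Finset.mul_sum]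
    refine Finset.sum_congr rfl fun k _ => ?_
    have := l.character_mul_character g k
    simp only [mul_left_comm (l.dim : ℂ), ← Finset.mul_sum]
    rw [← this]
    ring
  rw [h1, Finset.sum_comm]
  have h2 : ∀ x, ∑ k, (l.dim : ℂ) * ((f k : ℂ) * l.character (g * (x * k * x⁻¹))) =
      (l.dim : ℂ) * ∑ k, (f k : ℂ) * l.character (g * k) := by
    intro x
    rw [Finset.mul_sum]
    refine Fintype.sum_equiv (MulAut.conj x).toEquiv _ _ fun k => ?_
    simp [hf.conj]
  simp only [h2, Finset.sum_const, Finset.card_univ, nsmul_eq_mul, ← Nat.card_eq_fintype_card]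
  ring

lemma hat_groupConv {f h : G → ℝ} (hf : IsSymmClass f) (hh : IsSymmClass h) (l : Irr G) :
    hat (groupConv f h) l = hat f l * hat h l := by
  have hd : (l.dim : ℂ) ≠ 0 := by exact_mod_cast l.dim_pos.ne'
  have key : (l.dim : ℂ) * hat (groupConv f h) l = l.dim * (hat f l * hat h l) := by
    rw [dim_mul_hat (hf.groupConv hh), ← mul_assoc, dim_mul_hat hf, Finset.sum_mul]
    simp only [mul_assoc, character_mul_dim_mul_hat hh, groupConv, Complex.ofReal_sum,
      Finset.sum_mul, Finset.mul_sum, Complex.ofReal_mul]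
    rw [Finset.sum_comm]
    refine Finset.sum_congr rfl fun x _ => ?_
    refine Fintype.sum_equiv (Equiv.mulLeft x⁻¹) _ _ fun k => ?_
    simp
  exact_mod_cast mul_left_cancel₀ hd key

lemma hat_add (f h : G → ℝ) (l : Irr G) :
    hat (fun g => f g + h g) l = hat f l + hat h l := by
  simp [hat, add_mul, Finset.sum_add_distrib, add_div]

lemma hat_const_mul (a : ℝ) (f : G → ℝ) (l : Irr G) :
    hat (fun g => a * f g) l = a * hat f l := by
  simp only [hat, Complex.ofReal_mul, mul_assoc, ← Finset.mul_sum, Complex.re_ofReal_mul,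
    mul_div_assoc]

lemma hat_indicator_one [DecidableEq G] (l : Irr G) :
    hat (fun g => if g = 1 then (1 : ℝ) else 0) l = 1 := by
  have hd : (l.dim : ℝ) ≠ 0 := by exact_mod_cast l.dim_pos.ne'
  simp [hat, character_one, hd]

/-- The Plancherel weight of an irreducible representation. -/
def weight (l : Irr G) : ℝ := (l.dim : ℝ) ^ 2 / Nat.card G

omit [Fintype G] in
lemma weight_nonneg (l : Irr G) : 0 ≤ l.weight := by
  unfold weight
  positivity

lemma sum_weight_mul_hat (f : G → ℝ) : ∑ l : Irr G, l.weight * hat f l = f 1 := by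
  classical
  have hG : (Nat.card G : ℂ) ≠ 0 := by exact_mod_cast Nat.card_pos.ne'
  have h1 : ∀ l : Irr G, l.weight * hat f l =
      (∑ g, (f g : ℂ) * ((Nat.card G : ℂ)⁻¹ * (l.dim * l.character g))).re := by
    intro l
    have hd : (l.dim : ℝ) ≠ 0 := by exact_mod_cast l.dim_pos.ne'
    have : ∑ g, (f g : ℂ) * ((Nat.card G : ℂ)⁻¹ * (l.dim * l.character g)) =
        (((Nat.card G : ℝ)⁻¹ * l.dim : ℝ) : ℂ) * ∑ g, (f g : ℂ) * l.character g := by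
      rw [Finset.mul_sum]
      refine Finset.sum_congr rfl fun g _ => ?_
      push_cast
      ring
    rw [this, Complex.re_ofReal_mul, weight, hat]
    field_simp
  simp only [h1]
  rw [← Complex.re_sum, Finset.sum_comm]
  simp only [← Finset.mul_sum, sum_dim_mul_character]
  simp

lemma sum_weight_mul_hat_mul_hat {f h : G → ℝ} (hf : IsSymmClass f) (hh : IsSymmClass h) :
    ∑ l : Irr G, l.weight * (hat f l * hat h l) = ∑ g, f g * h g := by
  simp only [← hat_groupConv hf hh, sum_weight_mul_hat, groupConv, mul_one, hh.inv]

/-- The transition weights of the reversible Markov chain on irreducible representations that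
multiplies class sums by `θ`. -/
def kernel (θ : G → ℝ) (l m : Irr G) : ℝ :=
  (l.dim : ℝ) * m.dim / (Nat.card G : ℝ) ^ 2 *
    (∑ g, (θ g : ℂ) * (l.character g * m.character g⁻¹)).re

lemma kernel_comm {θ : G → ℝ} (hθ : ∀ g, θ g⁻¹ = θ g) (l m : Irr G) :
    kernel θ l m = kernel θ m l := by
  rw [kernel, kernel, mul_comm (l.dim : ℝ)]
  congr 2
  refine Fintype.sum_equiv (Equiv.inv G) _ _ fun g => ?_
  simp [hθ, mul_comm (l.character g)]

/-- Fourier inversion: the regular character collapses the sum over `m` of `dim m * hat f m *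
χ^m(g⁻¹)` to `|G| f(g)`, so the kernel acts as pointwise multiplication by `θ`. -/
lemma sum_kernel_mul_hat (θ : G → ℝ) {f : G → ℝ} (hf : IsSymmClass f) (l : Irr G) :
    ∑ m, kernel θ l m * hat f m = l.weight * hat (fun g => θ g * f g) l := by
  classical
  have hG : (Nat.card G : ℂ) ≠ 0 := by exact_mod_cast Nat.card_pos.ne'
  have hG' : (Nat.card G : ℝ) ≠ 0 := by exact_mod_cast Nat.card_pos.ne'
  have hd : (l.dim : ℝ) ≠ 0 := by exact_mod_cast l.dim_pos.ne'
  have h1 : ∀ m : Irr G, kernel θ l m * hat f m = (l.dim : ℝ) / (Nat.card G : ℝ) ^ 2 *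
      (∑ g, (θ g : ℂ) * (l.character g * ∑ k, (f k : ℂ) *
        (m.dim * m.character (g⁻¹ * k)))).re := by
    intro m
    have : ∑ g, (θ g : ℂ) * (l.character g * ∑ k, (f k : ℂ) * (m.dim * m.character (g⁻¹ * k))) =
        ((m.dim * hat f m : ℝ) : ℂ) * ∑ g, (θ g : ℂ) * (l.character g * m.character g⁻¹) := by
      rw [Finset.mul_sum]
      refine Finset.sum_congr rfl fun g _ => ?_
      simp only [mul_left_comm _ (m.dim : ℂ), ← Finset.mul_sum, ← character_mul_dim_mul_hat hf]
      push_cast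
      ring
    rw [this, Complex.re_ofReal_mul, kernel]
    ring
  simp only [h1]
  rw [← Finset.mul_sum, ← Complex.re_sum, Finset.sum_comm]
  simp only [← Finset.mul_sum]
  have h2 : ∀ g : G, ∑ m : Irr G, ∑ k, (f k : ℂ) * (m.dim * m.character (g⁻¹ * k)) =
      Nat.card G * f g := by
    intro g
    rw [Finset.sum_comm]
    simp only [← Finset.mul_sum, sum_dim_mul_character, inv_mul_eq_one]
    simp [mul_comm]
  simp only [h2]
  have h3 : ∑ g, (θ g : ℂ) * (l.character g * (Nat.card G * f g)) =
      ((Nat.card G : ℝ) : ℂ) * ∑ g, ((θ g * f g : ℝ) : ℂ) * l.character g := by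
    rw [Finset.mul_sum]
    refine Finset.sum_congr rfl fun g _ => ?_
    push_cast
    ring
  rw [h3, Complex.re_ofReal_mul, weight, hat]
  field_simp

/-- The delta function at 1 has all scalars equal to 1 and is unchanged by multiplication by `θ`. -/
lemma sum_kernel {θ : G → ℝ} (hθ : θ 1 = 1) (l : Irr G) : ∑ m, kernel θ l m = l.weight := by
  classical
  have hs : IsSymmClass (fun g : G => if g = 1 then (1 : ℝ) else 0) :=
    ⟨fun g h => by simp, fun g => by simp⟩
  have h := sum_kernel_mul_hat θ hs l
  have h' : (fun g : G => θ g * if g = 1 then (1 : ℝ) else 0) =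
      fun g => if g = 1 then (1 : ℝ) else 0 := by
    ext g
    by_cases hg : g = 1 <;> simp [hg, hθ]
  simpa only [h', hat_indicator_one, mul_one] using h

/-- Since `θ` is a positive combination of subgroup indicators, the kernel is a positive combination
of scalar products of restricted characters, which are dimensions of spaces of intertwiners. -/
lemma kernel_nonneg {ι : Type} [Fintype ι] (H : ι → Subgroup G) {θ : G → ℝ} {a : ℝ} (ha : 0 ≤ a)
    (hθ : ∀ g, θ g = a * Nat.card {j // g ∈ H j}) (l m : Irr G) : 0 ≤ kernel θ l m := by
  classical
  refine mul_nonneg (by positivity) ?_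
  have h1 : ∑ g, (θ g : ℂ) * (l.character g * m.character g⁻¹) =
      (a : ℂ) * ∑ j, ∑ h : H j, l.character h * m.character (h⁻¹ : G) := by
    have : ∀ j, ∑ h : H j, l.character h * m.character (h⁻¹ : G) =
        ∑ g, if g ∈ H j then l.character g * m.character g⁻¹ else 0 := by
      intro j
      rw [← Finset.sum_filter]
      exact (Finset.sum_subtype _ (by simp) fun g => l.character g * m.character g⁻¹).symm
    simp only [this]
    rw [Finset.sum_comm, Finset.mul_sum]
    refine Finset.sum_congr rfl fun g _ => ?_
    rw [← Finset.sum_filter, Finset.sum_const, hθ, Nat.card_eq_fintype_card, Fintype.card_subtype]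
    push_cast
    rw [nsmul_eq_mul]
    ring
  choose d hd using fun j => sum_subgroup_character_mul_character l m (H j)
  rw [h1]
  simp only [hd]
  have : (a : ℂ) * ∑ j, (Nat.card (H j) : ℂ) * d j =
      ((a * ∑ j, (Nat.card (H j) : ℝ) * d j : ℝ) : ℂ) := by push_cast; rfl
  rw [this, Complex.ofReal_re]
  positivity

lemma plancherel_real (s : Set (Irr G)) [DecidablePred (· ∈ s)] :
    (plancherel G).real s = ∑ l, if l ∈ s then l.weight else 0 := by
  have hs : ∀ t : Set (Irr G), MeasurableSet t := fun _ => MeasurableSpace.measurableSet_top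
  rw [Measure.real, plancherel, Measure.sum_apply _ (hs s), tsum_fintype, ENNReal.toReal_sum]
  · refine Finset.sum_congr rfl fun l _ => ?_
    rw [Measure.smul_apply, Measure.dirac_apply' _ (hs s)]
    by_cases hl : l ∈ s <;> simp [hl, weight]
  · intro l _
    rw [Measure.smul_apply, Measure.dirac_apply' _ (hs s)]
    by_cases hl : l ∈ s <;> simp [hl]
    refine ENNReal.div_ne_top (by simp) (by simp)

end Fourier

end Irr

/-! ### Gaussian tail estimates. -/

namespace Stein

open Real Set

/-- The unnormalized Gaussian density. -/
def gauss (x : ℝ) : ℝ := exp (-x ^ 2 / 2)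

lemma gauss_eq (x : ℝ) : gauss x = exp (-(1 / 2) * x ^ 2) := by
  rw [gauss]
  ring_nf

lemma gauss_pos (x : ℝ) : 0 < gauss x := exp_pos _

lemma gauss_le_one (x : ℝ) : gauss x ≤ 1 := by
  rw [gauss, exp_le_one_iff]
  nlinarith [sq_nonneg x]

lemma gauss_neg (x : ℝ) : gauss (-x) = gauss x := by simp [gauss]

lemma continuous_gauss : Continuous gauss := by
  unfold gauss
  fun_prop

lemma hasDerivAt_gauss (x : ℝ) : HasDerivAt gauss (-x * gauss x) x := by
  have h : HasDerivAt (fun y : ℝ => -y ^ 2 / 2) (-x) x := by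
    refine HasDerivAt.congr_deriv ((hasDerivAt_pow 2 x).neg.div_const 2) ?_
    norm_num
    ring
  have := h.exp
  rw [mul_comm] at this
  exact this

lemma integrable_gauss : Integrable gauss := by
  have := integrable_exp_neg_mul_sq (b := 1 / 2) (by norm_num)
  simpa only [← gauss_eq] using this

lemma integral_gauss : ∫ x, gauss x = √(2 * π) := by
  have := integral_gaussian (1 / 2)
  simp only [← gauss_eq] at this
  rw [this]
  congr 1
  ring

/-- The Gaussian tail. -/
def tail (x : ℝ) : ℝ := ∫ t in Ioi x, gauss t

lemma integral_Iic_gauss (x : ℝ) : ∫ t in Iic x, gauss t = tail (-x) := by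
  have := integral_comp_neg_Iic x gauss
  simp only [gauss_neg] at this
  exact this

/-- After translating by `x`, use `(t + x)² ≥ t² + x²` for `t, x ≥ 0`; the half-line integral
`√(2π)/2` is at most 2. -/
lemma tail_le_two_mul {x : ℝ} (hx : 0 ≤ x) : tail x ≤ 2 * gauss x := by
  have h1 : tail x = ∫ t in Ioi (0 : ℝ), gauss (t + x) := by
    have := (measurePreserving_add_right volume x).setIntegral_preimage_emb
      (measurableEmbedding_addRight x) gauss (Ioi x)
    rw [tail, ← this]
    congr 2
    ext t
    simp
  have h2 : ∫ t in Ioi (0 : ℝ), gauss (t + x) ≤ ∫ t in Ioi (0 : ℝ), gauss x * gauss t := by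
    refine setIntegral_mono_on (integrable_gauss.comp_add_right x).integrableOn
      (integrable_gauss.const_mul _).integrableOn measurableSet_Ioi fun t ht => ?_
    rw [gauss, gauss, gauss, ← exp_add, exp_le_exp]
    nlinarith [mul_nonneg hx (le_of_lt ht)]
  have h3 : ∫ t in Ioi (0 : ℝ), gauss t = √(2 * π) / 2 := by
    have := integral_gaussian_Ioi (1 / 2)
    simp only [← gauss_eq] at this
    rw [this]
    congr 2
    ring
  rw [integral_const_mul, h3] at h2
  have h4 : √(2 * π) ≤ 4 := by
    rw [sqrt_le_left (by norm_num)]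
    nlinarith [pi_lt_four]
  rw [h1]
  nlinarith [gauss_pos x]

lemma mul_tail_le {x : ℝ} : x * tail x ≤ gauss x := by
  have hint : Integrable fun t => t * gauss t := by
    have := integrable_mul_exp_neg_mul_sq (b := 1 / 2) (by norm_num)
    simpa only [← gauss_eq] using this
  have htend : Filter.Tendsto (fun t => -gauss t) Filter.atTop (nhds 0) := by
    have h0 : Filter.Tendsto gauss Filter.atTop (nhds 0) := by
      refine tendsto_exp_atBot.comp ?_
      simp only [neg_div]
      exact Filter.tendsto_neg_atTop_atBot.comp
        ((Filter.tendsto_pow_atTop two_ne_zero).atTop_div_const two_pos)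
    simpa using h0.neg
  have h1 : ∫ t in Ioi x, t * gauss t = gauss x := by
    have := integral_Ioi_of_hasDerivAt_of_tendsto' (a := x) (f := fun t => -gauss t)
      (f' := fun t => t * gauss t) (fun t _ =>
        (hasDerivAt_gauss t).neg.congr_deriv (by ring)) hint.integrableOn htend
    simpa using this
  rw [tail, ← h1, ← integral_const_mul]
  exact setIntegral_mono_on (integrable_gauss.const_mul _).integrableOn hint.integrableOn
    measurableSet_Ioi fun t ht => mul_le_mul_of_nonneg_right (le_of_lt ht) (gauss_pos t).le

/-- The expectation under the standard Gaussian. -/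
def gaussMean (h : ℝ → ℝ) : ℝ := (√(2 * π))⁻¹ * ∫ x, h x * gauss x

/-! ### The Stein equation `f' - x f = h - E h` and regularity of its solution. -/

section Solution

variable {h : ℝ → ℝ} (hc : Continuous h) (h01 : ∀ x, h x ∈ Icc (0 : ℝ) 1)

include hc h01

lemma integrable_mul_gauss : Integrable fun x => h x * gauss x := by
  refine integrable_gauss.mono' (hc.mul continuous_gauss).aestronglyMeasurable
    (Filter.Eventually.of_forall fun x => ?_)
  rw [norm_mul, norm_of_nonneg (h01 x).1, norm_of_nonneg (gauss_pos x).le]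
  nlinarith [(h01 x).2, gauss_pos x]

lemma gaussMean_mem : gaussMean h ∈ Icc (0 : ℝ) 1 := by
  have hpos : 0 < √(2 * π) := by positivity
  constructor
  · exact mul_nonneg (by positivity) (integral_nonneg fun x =>
      mul_nonneg (h01 x).1 (gauss_pos x).le)
  · rw [gaussMean, inv_mul_le_iff₀ hpos, mul_one, ← integral_gauss]
    refine integral_mono (integrable_mul_gauss hc h01) integrable_gauss fun x => ?_
    simp only
    nlinarith [(h01 x).2, gauss_pos x]

lemma abs_sub_gaussMean_le (x : ℝ) : |h x - gaussMean h| ≤ 1 := by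
  have h1 := h01 x
  have h2 := gaussMean_mem hc h01
  rw [abs_le]
  constructor <;> linarith [h1.1, h1.2, h2.1, h2.2]

lemma integrable_centered : Integrable fun x => (h x - gaussMean h) * gauss x := by
  have := (integrable_mul_gauss hc h01).sub (integrable_gauss.const_mul (gaussMean h))
  simp only [sub_mul]
  exact this

lemma integral_centered : ∫ x, (h x - gaussMean h) * gauss x = 0 := by
  simp only [sub_mul]
  rw [integral_sub (integrable_mul_gauss hc h01) (integrable_gauss.const_mul _),
    integral_const_mul, integral_gauss, gaussMean]
  have hpos : 0 < √(2 * π) := by positivity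
  field_simp
  ring

lemma abs_setIntegral_centered_le (s : Set ℝ) :
    |∫ x in s, (h x - gaussMean h) * gauss x| ≤ ∫ x in s, gauss x := by
  refine norm_integral_le_of_norm_le (f := fun x => (h x - gaussMean h) * gauss x)
    integrable_gauss.integrableOn
    (Filter.Eventually.of_forall fun x => ?_)
  rw [norm_mul, norm_of_nonneg (gauss_pos x).le]
  have := abs_sub_gaussMean_le hc h01 x
  rw [norm_eq_abs]
  nlinarith [gauss_pos x]

/-- The solution is the primitive of `(h - E h) * gauss` from `-∞`, divided by `gauss`. -/
lemma exists_solution : ∃ f f' : ℝ → ℝ, (∀ x, HasDerivAt f (f' x) x) ∧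
    (∀ x, f' x = x * f x + (h x - gaussMean h)) ∧ (∀ x, |f x| ≤ 2) ∧ ∀ x, |x * f x| ≤ 1 := by
  set q : ℝ → ℝ := fun x => (h x - gaussMean h) * gauss x with hq
  have hqc : Continuous q := (hc.sub continuous_const).mul continuous_gauss
  have hqi : Integrable q := integrable_centered hc h01
  set F : ℝ → ℝ := fun x => ∫ t in Iic x, q t with hF
  have hFd : ∀ x, HasDerivAt F (q x) x := by
    intro x
    have h1 : F = fun x => (∫ t in (0 : ℝ)..x, q t) + F 0 := by
      ext y
      rw [← intervalIntegral.integral_Iic_sub_Iic hqi.integrableOn hqi.integrableOn]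
      simp [hF]
    rw [h1]
    exact (intervalIntegral.integral_hasDerivAt_right (hqc.intervalIntegrable _ _)
      (hqc.stronglyMeasurableAtFilter _ _) hqc.continuousAt).add_const _
  have hFbound : ∀ x, |F x| ≤ tail |x| := by
    intro x
    rcases le_total 0 x with hx | hx
    -- The total integral of `q` vanishes, so for `x ≥ 0` the primitive can be bounded by the right
    -- tail.
    · have h1 : F x = -∫ t in Ioi x, q t := by
        have h2 := integral_add_compl (measurableSet_Iic (a := x)) hqi
        rw [integral_centered hc h01, compl_Iic] at h2
        linarith
      rw [h1, abs_neg, abs_of_nonneg hx]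
      exact abs_setIntegral_centered_le hc h01 _
    · rw [abs_of_nonpos hx, ← integral_Iic_gauss]
      exact abs_setIntegral_centered_le hc h01 _
  have hg : ∀ x, gauss |x| = gauss x := fun x => by simp [gauss]
  refine ⟨fun x => F x / gauss x, fun x => x * (F x / gauss x) + (h x - gaussMean h),
    fun x => ?_, fun x => rfl, fun x => ?_, fun x => ?_⟩
  · have := (hFd x).div (hasDerivAt_gauss x) (gauss_pos x).ne'
    refine this.congr_deriv ?_
    have := (gauss_pos x).ne'
    field_simp
    ring
  · rw [abs_div, abs_of_pos (gauss_pos x), div_le_iff₀ (gauss_pos x)]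
    refine (hFbound x).trans ?_
    rw [← hg]
    exact tail_le_two_mul (abs_nonneg x)
  · rw [abs_mul, abs_div, abs_of_pos (gauss_pos x), mul_div_assoc', div_le_iff₀ (gauss_pos x),
      one_mul, ← hg]
    exact (mul_le_mul_of_nonneg_left (hFbound x) (abs_nonneg x)).trans mul_tail_le

/-- As `h` is only Lipschitz, `f` need not have a second derivative. The equation instead shows that
`f'` is locally Lipschitz, with a constant of linear growth coming from the derivative `f + t f'` of
`t f`. -/
lemma exists_solution_taylor {K : ℝ} (hK : ∀ x y, |h y - h x| ≤ K * |y - x|) :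
    ∃ f f' : ℝ → ℝ, (∀ x, f' x = x * f x + (h x - gaussMean h)) ∧ (∀ x, |f' x| ≤ 2) ∧
      ∀ x y, |f y - f x - f' x * (y - x)| ≤ (2 + 4 * (|x| + |y|) + K) * (y - x) ^ 2 := by
  obtain ⟨f, f', hd, heq, hb, hxb⟩ := exists_solution hc h01
  have hb' : ∀ x, |f' x| ≤ 2 := fun x => by
    rw [heq]
    exact (abs_add_le _ _).trans (by linarith [hxb x, abs_sub_gaussMean_le hc h01 x])
  have hseg : ∀ x y t : ℝ, t ∈ uIcc x y → |t| ≤ |x| + |y| ∧ |t - x| ≤ |y - x| := by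
    intro x y t ht
    refine ⟨?_, abs_sub_left_of_mem_uIcc ht⟩
    rcases mem_uIcc.1 ht with h | h <;>
    · rw [abs_le]
      constructor <;>
        linarith [neg_abs_le x, le_abs_self x, neg_abs_le y, le_abs_self y, h.1, h.2,
          abs_nonneg x, abs_nonneg y]
  have hlip : ∀ x y, |f' y - f' x| ≤ (2 + 2 * (|x| + |y|) + K) * |y - x| := by
    intro x y
    have h1 : |y * f y - x * f x| ≤ (2 + 2 * (|x| + |y|)) * |y - x| := by
      refine Convex.norm_image_sub_le_of_norm_hasDerivWithin_le (f := fun t => t * f t)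
        (f' := fun t => 1 * f t + t * f' t) (s := uIcc x y)
        (fun t _ => ((hasDerivAt_id t).mul (hd t)).hasDerivWithinAt) (fun t ht => ?_)
        (convex_uIcc x y) left_mem_uIcc right_mem_uIcc
      rw [norm_eq_abs, one_mul]
      refine (abs_add_le _ _).trans ?_
      rw [abs_mul]
      nlinarith [(hseg x y t ht).1, hb t, hb' t, abs_nonneg t, abs_nonneg (f' t)]
    have h2 := hK x y
    rw [heq, heq]
    have h3 : y * f y + (h y - gaussMean h) - (x * f x + (h x - gaussMean h)) =
        (y * f y - x * f x) + (h y - h x) := by ring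
    rw [h3]
    refine (abs_add_le _ _).trans ?_
    linarith
  refine ⟨f, f', heq, hb', fun x y => ?_⟩
  have hK0 : 0 ≤ K := by
    have := hK 0 1
    norm_num at this
    exact (abs_nonneg _).trans this
  -- Mean value inequality for the first-order remainder. The 2 of `hlip` becomes 4 because `|t| ≤
  -- |x| + |y|` on the segment.
  have h1 := Convex.norm_image_sub_le_of_norm_hasDerivWithin_le (f := fun t => f t - f' x * t)
    (f' := fun t => f' t - f' x * 1) (s := uIcc x y)
    (C := (2 + 4 * (|x| + |y|) + K) * |y - x|)
    (fun t _ => ((hd t).sub ((hasDerivAt_id t).const_mul _)).hasDerivWithinAt) (fun t ht => by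
      rw [norm_eq_abs, mul_one]
      refine (hlip x t).trans ?_
      have := hseg x y t ht
      have h4 : 0 ≤ 2 + 2 * (|x| + |t|) + K := by positivity
      refine mul_le_mul ?_ this.2 (abs_nonneg _) (by positivity)
      linarith [this.1, abs_nonneg y])
    (convex_uIcc x y) left_mem_uIcc right_mem_uIcc
  rw [norm_eq_abs, norm_eq_abs, mul_assoc, abs_mul_abs_self] at h1
  convert h1 using 1
  · congr 1
    ring
  · ring

end Solution

/-! ### Exchangeable pairs and smoothing. -/

section Pair

variable {Λ : Type*} [Fintype Λ]

/-- Stein's method of exchangeable pairs on a finite space, for Lipschitz test functions. -/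
theorem abs_sum_sub_gaussMean_le {P W V : Λ → ℝ} {p : Λ → Λ → ℝ} {a ε B K : ℝ}
    (ha : 0 < a) (hε : 0 < ε)
    (hp : ∀ l m, 0 ≤ p l m) (hsymm : ∀ l m, p l m = p m l) (hP : ∀ l, ∑ m, p l m = P l)
    (hP1 : ∑ l, P l = 1) (hW : ∀ l, ∑ m, p l m * W m = P l * ((1 - a) * W l))
    (hV : ∀ l, ∑ m, p l m * (W m - W l) ^ 2 = P l * V l)
    (h2 : ∑ l, ∑ m, p l m * (W m - W l) ^ 2 ≤ B * a)
    (h4 : ∑ l, ∑ m, p l m * (W m - W l) ^ 4 ≤ B * a * ε ^ 2)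
    (h22 : ∑ l, ∑ m, p l m * ((W m - W l) ^ 2 * W l ^ 2) ≤ B * a)
    (hvar : ∑ l, P l * (V l - 2 * a) ^ 2 ≤ B * a ^ 2 * ε ^ 2)
    {h : ℝ → ℝ} (hc : Continuous h) (h01 : ∀ x, h x ∈ Icc (0 : ℝ) 1)
    (hK : ∀ x y, |h y - h x| ≤ K * |y - x|) :
    |∑ l, P l * h (W l) - gaussMean h| ≤ ε * (1 + (6 + K) * B) := by
  obtain ⟨f, f', heq, hb, htay⟩ := exists_solution_taylor hc h01 hK
  have hK0 : 0 ≤ K := by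
    have := hK 0 1
    norm_num at this
    exact (abs_nonneg _).trans this
  have hP0 : ∀ l, 0 ≤ P l := fun l => hP l ▸ Finset.sum_nonneg fun m _ => hp l m
  set r : Λ → Λ → ℝ := fun l m => f (W m) - f (W l) - f' (W l) * (W m - W l) with hr
  have h1 : ∑ l, P l * h (W l) - gaussMean h = ∑ l, P l * (f' (W l) - W l * f (W l)) := by
    have : ∀ l, P l * (f' (W l) - W l * f (W l)) = P l * h (W l) - P l * gaussMean h := by
      intro l
      rw [heq]
      ring
    simp only [this]
    rw [Finset.sum_sub_distrib, ← Finset.sum_mul, hP1, one_mul]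
  have h5 : a * ∑ l, P l * (W l * f (W l)) = ∑ l, ∑ m, p l m * (W l - W m) * f (W l) := by
    rw [Finset.mul_sum]
    refine Finset.sum_congr rfl fun l _ => ?_
    have : ∑ m, p l m * (W l - W m) * f (W l) =
        ((∑ m, p l m) * W l - ∑ m, p l m * W m) * f (W l) := by
      rw [Finset.sum_mul, ← Finset.sum_sub_distrib, Finset.sum_mul]
      exact Finset.sum_congr rfl fun m _ => by ring
    rw [this, hP, hW]
    ring
  -- The exchangeable-pair identity: symmetrizing `h5` in `l` and `m` doubles it into a product of
  -- increments.
  have h6 : 2 * a * ∑ l, P l * (W l * f (W l)) =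
      ∑ l, ∑ m, p l m * (W m - W l) * (f (W m) - f (W l)) := by
    have h7 : ∑ l, ∑ m, p l m * (W l - W m) * f (W l) =
        ∑ l, ∑ m, p l m * (W m - W l) * f (W m) := by
      rw [Finset.sum_comm]
      exact Finset.sum_congr rfl fun l _ => Finset.sum_congr rfl fun m _ => by rw [hsymm]
    rw [mul_assoc, two_mul, h5]
    nth_rewrite 1 [h7]
    rw [← Finset.sum_add_distrib]
    refine Finset.sum_congr rfl fun l _ => ?_
    rw [← Finset.sum_add_distrib]
    exact Finset.sum_congr rfl fun m _ => by ring
  have h8 : 2 * a * ∑ l, P l * (f' (W l) - W l * f (W l)) =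
      ∑ l, P l * (f' (W l) * (2 * a - V l)) - ∑ l, ∑ m, p l m * (W m - W l) * r l m := by
    have h9 : ∑ l, ∑ m, p l m * (W m - W l) * r l m =
        ∑ l, ∑ m, p l m * (W m - W l) * (f (W m) - f (W l)) - ∑ l, f' (W l) * (P l * V l) := by
      rw [← Finset.sum_sub_distrib]
      refine Finset.sum_congr rfl fun l _ => ?_
      rw [← hV, Finset.mul_sum, ← Finset.sum_sub_distrib]
      exact Finset.sum_congr rfl fun m _ => by simp only [hr]; ring
    rw [h9, ← h6]
    simp only [Finset.mul_sum, ← Finset.sum_sub_distrib, sub_sub_eq_add_sub]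
    exact Finset.sum_congr rfl fun m _ => by ring
  have h10 : |∑ l, P l * (f' (W l) * (2 * a - V l))| ≤ a * ε * (1 + B) := by
    have hpt : ∀ l, |P l * (f' (W l) * (2 * a - V l))| ≤
        P l * (a * ε) + P l * (V l - 2 * a) ^ 2 * (a * ε)⁻¹ := by
      intro l
      have haε : 0 < a * ε := mul_pos ha hε
      rw [abs_mul, abs_of_nonneg (hP0 l), abs_mul, mul_assoc, ← mul_add]
      refine mul_le_mul_of_nonneg_left ?_ (hP0 l)
      -- AM-GM in place of Cauchy–Schwarz; the factor 2 absorbs `|f'| ≤ 2`.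
      have h11 : 2 * |2 * a - V l| ≤ a * ε + (V l - 2 * a) ^ 2 * (a * ε)⁻¹ := by
        rw [← sub_le_iff_le_add', ← div_eq_mul_inv, le_div_iff₀ haε]
        rw [abs_sub_comm, ← sq_abs (V l - 2 * a)]
        nlinarith [sq_nonneg (|V l - 2 * a| - a * ε)]
      nlinarith [hb (W l), abs_nonneg (2 * a - V l)]
    refine (Finset.abs_sum_le_sum_abs _ _).trans ((Finset.sum_le_sum fun l _ => hpt l).trans ?_)
    rw [Finset.sum_add_distrib, ← Finset.sum_mul, ← Finset.sum_mul, hP1]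
    have : (∑ l, P l * (V l - 2 * a) ^ 2) * (a * ε)⁻¹ ≤ B * a ^ 2 * ε ^ 2 * (a * ε)⁻¹ :=
      mul_le_mul_of_nonneg_right hvar (by positivity)
    have h12 : B * a ^ 2 * ε ^ 2 * (a * ε)⁻¹ = B * (a * ε) := by field_simp
    linarith
  have h22' : ∑ l, ∑ m, p l m * ((W m - W l) ^ 2 * W m ^ 2) ≤ B * a := by
    refine le_of_eq_of_le ?_ h22
    rw [Finset.sum_comm]
    exact Finset.sum_congr rfl fun l _ => Finset.sum_congr rfl fun m _ => by rw [hsymm]; ring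
  have h13 : |∑ l, ∑ m, p l m * (W m - W l) * r l m| ≤ a * ε * ((10 + K) * B) := by
    have hpt : ∀ l m, |p l m * (W m - W l) * r l m| ≤
        (5 + K / 2) * ε⁻¹ * (p l m * (W m - W l) ^ 4) +
        (1 + K / 2) * ε * (p l m * (W m - W l) ^ 2) +
        2 * ε * (p l m * ((W m - W l) ^ 2 * W l ^ 2)) +
        2 * ε * (p l m * ((W m - W l) ^ 2 * W m ^ 2)) := by
      intro l m
      set D := W m - W l with hD
      have hmain : |D| * |r l m| ≤ (5 + K / 2) * ε⁻¹ * D ^ 4 + (1 + K / 2) * ε * D ^ 2 +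
          2 * ε * (D ^ 2 * W l ^ 2) + 2 * ε * (D ^ 2 * W m ^ 2) := by
        -- The Taylor remainder contributes `|D|³` times 1, `|W l|` or `|W m|`. Weighted AM-GM
        -- splits each such term into the fourth-moment and second-moment quantities that are
        -- assumed bounded.
        have ham : ∀ u : ℝ, |D| * D ^ 2 * |u| ≤ (ε⁻¹ * D ^ 4 + ε * (D ^ 2 * u ^ 2)) / 2 := by
          intro u
          have h14 : ε⁻¹ * D ^ 4 + ε * (D ^ 2 * u ^ 2) - 2 * (|D| * D ^ 2 * |u|) =
              D ^ 2 * ε * (ε⁻¹ * |D| - |u|) ^ 2 := by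
            have e1 : D ^ 4 = D ^ 2 * |D| ^ 2 := by rw [sq_abs]; ring
            rw [e1, ← sq_abs u]
            field_simp
            ring
          have : 0 ≤ D ^ 2 * ε * (ε⁻¹ * |D| - |u|) ^ 2 := by positivity
          linarith
        have h15 := ham 1
        have h16 := ham (W l)
        have h17 := ham (W m)
        rw [abs_one] at h15
        have h18 : |D| * |r l m| ≤ |D| * ((2 + 4 * (|W l| + |W m|) + K) * D ^ 2) :=
          mul_le_mul_of_nonneg_left (htay (W l) (W m)) (abs_nonneg _)
        have h19 : (2 + K) * (|D| * D ^ 2 * 1) ≤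
            (2 + K) * ((ε⁻¹ * D ^ 4 + ε * (D ^ 2 * 1 ^ 2)) / 2) :=
          mul_le_mul_of_nonneg_left h15 (by positivity)
        nlinarith
      rw [abs_mul, abs_mul, abs_of_nonneg (hp l m), mul_assoc]
      have := mul_le_mul_of_nonneg_left hmain (hp l m)
      linarith
    refine (Finset.abs_sum_le_sum_abs _ _).trans ((Finset.sum_le_sum fun l _ =>
      (Finset.abs_sum_le_sum_abs _ _).trans (Finset.sum_le_sum fun m _ => hpt l m)).trans ?_)
    simp only [Finset.sum_add_distrib, ← Finset.mul_sum]
    have e1 : (5 + K / 2) * ε⁻¹ * ∑ l, ∑ m, p l m * (W m - W l) ^ 4 ≤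
        (5 + K / 2) * ε⁻¹ * (B * a * ε ^ 2) := mul_le_mul_of_nonneg_left h4 (by positivity)
    have e2 : (1 + K / 2) * ε * ∑ l, ∑ m, p l m * (W m - W l) ^ 2 ≤
        (1 + K / 2) * ε * (B * a) := mul_le_mul_of_nonneg_left h2 (by positivity)
    have e3 := mul_le_mul_of_nonneg_left h22 (by positivity : 0 ≤ 2 * ε)
    have e4 := mul_le_mul_of_nonneg_left h22' (by positivity : 0 ≤ 2 * ε)
    have e5 : (5 + K / 2) * ε⁻¹ * (B * a * ε ^ 2) = (5 + K / 2) * (B * a * ε) := by field_simp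
    linarith
  rw [h1]
  have h20 : |2 * a * ∑ l, P l * (f' (W l) - W l * f (W l))| ≤
      a * ε * (1 + B) + a * ε * ((10 + K) * B) := by
    rw [h8]
    exact (abs_sub _ _).trans (add_le_add h10 h13)
  rw [abs_mul, abs_of_pos (by positivity : 0 < 2 * a)] at h20
  have hB : 0 ≤ B := by
    have : 0 ≤ ∑ l, ∑ m, p l m * (W m - W l) ^ 2 :=
      Finset.sum_nonneg fun l _ => Finset.sum_nonneg fun m _ => mul_nonneg (hp l m) (sq_nonneg _)
    nlinarith
  -- Slack that rounds the total `1 + B + (10 + K) * B` up to twice `1 + (6 + K) * B`.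
  have h21 : 0 ≤ a * ε * (1 + (1 + K) * B) := by positivity
  have h23 : 2 * a * |∑ l, P l * (f' (W l) - W l * f (W l))| ≤
      2 * a * (ε * (1 + (6 + K) * B)) := by linarith
  exact le_of_mul_le_mul_left h23 (by positivity)

/-- Passing from Lipschitz test functions to distribution functions. -/
theorem abs_sum_indicator_sub_le {P W : Λ → ℝ} (hP : ∀ l, 0 ≤ P l) {δ η : ℝ} (hδ : 0 < δ)
    (H : ∀ h : ℝ → ℝ, Continuous h → (∀ x, h x ∈ Icc (0 : ℝ) 1) →
      (∀ x y, |h y - h x| ≤ δ⁻¹ * |y - x|) → |∑ l, P l * h (W l) - gaussMean h| ≤ η) (x₀ : ℝ) :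
    |(∑ l, if W l ≤ x₀ then P l else 0) - (√(2 * π))⁻¹ * ∫ x in Iic x₀, gauss x| ≤ η + δ := by
  set Φ : ℝ → ℝ := fun x => (√(2 * π))⁻¹ * ∫ t in Iic x, gauss t with hΦ
  have hs : 0 < √(2 * π) := by positivity
  have hs1 : (√(2 * π))⁻¹ ≤ 1 := by
    refine inv_le_one_of_one_le₀ ?_
    rw [one_le_sqrt]
    linarith [pi_gt_three]
  have hΦstep : ∀ x, Φ (x + δ) ≤ Φ x + δ := by
    intro x
    have h1 : (∫ t in Iic (x + δ), gauss t) - ∫ t in Iic x, gauss t =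
        ∫ t in x..(x + δ), gauss t :=
      intervalIntegral.integral_Iic_sub_Iic integrable_gauss.integrableOn
        integrable_gauss.integrableOn
    have h2 : ∫ t in x..(x + δ), gauss t ≤ ∫ t in x..(x + δ), (1 : ℝ) :=
      intervalIntegral.integral_mono_on (by linarith)
        (continuous_gauss.intervalIntegrable _ _) (by simp) fun t _ => gauss_le_one t
    rw [intervalIntegral.integral_const, add_sub_cancel_left, smul_eq_mul, mul_one, ← h1] at h2
    have h3 := mul_le_mul_of_nonneg_left h2 (inv_pos.2 hs).le
    rw [mul_sub] at h3
    have h4 := mul_le_mul_of_nonneg_right hs1 hδ.le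
    simp only [hΦ]
    linarith
  -- `ψ x` is 1 up to `x`, 0 from `x + δ` on, and linear between. The indicator of `t ≤ x₀` lies
  -- between `ψ (x₀ - δ)` and `ψ x₀`.
  let ψ : ℝ → ℝ → ℝ := fun x t => max 0 (min 1 (δ⁻¹ * (x + δ - t)))
  have hψc : ∀ x, Continuous (ψ x) := fun x => by fun_prop
  have hψ01 : ∀ x t, ψ x t ∈ Icc (0 : ℝ) 1 := fun x t =>
    ⟨le_max_left _ _, max_le zero_le_one (min_le_left _ _)⟩
  have hψL : ∀ x s t, |ψ x t - ψ x s| ≤ δ⁻¹ * |t - s| := by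
    intro x s t
    refine (abs_max_sub_max_le_max _ _ _ _).trans ?_
    refine max_le (by simp; positivity) ((abs_min_sub_min_le_max _ _ _ _).trans ?_)
    refine max_le (by simp; positivity) ?_
    rw [← mul_sub, abs_mul, abs_of_pos (inv_pos.2 hδ), sub_sub_sub_cancel_left, abs_sub_comm]
  have hψ1 : ∀ x t, t ≤ x → ψ x t = 1 := by
    intro x t ht
    have : 1 ≤ δ⁻¹ * (x + δ - t) := by
      rw [inv_mul_eq_div, le_div_iff₀ hδ]
      linarith
    simp [ψ, this]
  have hψ0 : ∀ x t, x + δ ≤ t → ψ x t = 0 := by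
    intro x t ht
    have : δ⁻¹ * (x + δ - t) ≤ 0 := mul_nonpos_of_nonneg_of_nonpos (by positivity) (by linarith)
    simp [ψ, this]
  have hint : ∀ x, Integrable (fun t => ψ x t * gauss t) := fun x =>
    integrable_mul_gauss (hψc x) (hψ01 x)
  have hlow : ∀ x, Φ x ≤ gaussMean (ψ x) := by
    intro x
    refine mul_le_mul_of_nonneg_left ?_ (by positivity)
    rw [← integral_indicator measurableSet_Iic]
    refine integral_mono (integrable_gauss.indicator measurableSet_Iic) (hint x) fun t => ?_
    by_cases ht : t ≤ x
    · simp [indicator, ht, hψ1 x t ht]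
    · simp only [indicator, mem_Iic, ht, if_false]
      exact mul_nonneg (hψ01 x t).1 (gauss_pos t).le
  have hup : ∀ x, gaussMean (ψ x) ≤ Φ (x + δ) := by
    intro x
    refine mul_le_mul_of_nonneg_left ?_ (by positivity)
    rw [← integral_indicator measurableSet_Iic]
    refine integral_mono (hint x) (integrable_gauss.indicator measurableSet_Iic) fun t => ?_
    by_cases ht : t ≤ x + δ
    · simp only [indicator, mem_Iic, ht, if_true]
      exact mul_le_of_le_one_left (gauss_pos t).le (hψ01 x t).2
    · simp [indicator, ht, hψ0 x t (not_le.1 ht).le]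
  have hF1 : (∑ l, if W l ≤ x₀ then P l else 0) ≤ ∑ l, P l * ψ x₀ (W l) := by
    refine Finset.sum_le_sum fun l _ => ?_
    split_ifs with hl
    · rw [hψ1 _ _ hl, mul_one]
    · exact mul_nonneg (hP l) (hψ01 _ _).1
  have hF2 : ∑ l, P l * ψ (x₀ - δ) (W l) ≤ ∑ l, if W l ≤ x₀ then P l else 0 := by
    refine Finset.sum_le_sum fun l _ => ?_
    split_ifs with hl
    · exact mul_le_of_le_one_right (hP l) (hψ01 _ _).2
    · rw [hψ0 _ _ (by linarith), mul_zero]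
  have e1 := abs_le.1 (H _ (hψc x₀) (hψ01 x₀) (hψL x₀))
  have e2 := abs_le.1 (H _ (hψc (x₀ - δ)) (hψ01 (x₀ - δ)) (hψL (x₀ - δ)))
  have e3 := hΦstep x₀
  have e4 := hΦstep (x₀ - δ)
  rw [sub_add_cancel] at e4
  change |_ - Φ x₀| ≤ _
  rw [abs_le]
  constructor <;> linarith [hlow x₀, hup x₀, hlow (x₀ - δ), e1.1, e1.2, e2.1, e2.2]

end Pair

end Stein

/-! ### Counting factorizations into two cycles. -/

namespace CycleCount

open Finset Equiv Equiv.Perm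
open scoped Nat

variable {α : Type} [Fintype α] [DecidableEq α]

lemma card_support_subset (U : Finset α) :
    #{g : Perm α | g.support ⊆ U} = (#U)! := by
  have h := Fintype.card_congr (Perm.subtypeEquivSubtypePerm (· ∈ U))
  rw [Fintype.card_perm, Fintype.card_coe, Fintype.card_subtype] at h
  rw [h]
  congr 1
  ext g
  simp only [mem_filter, mem_univ, true_and]
  refine forall_congr' fun x => ?_
  rw [mem_support, ← not_imp_not, not_not]

omit [Fintype α] in
lemma exists_subset_image [Nonempty α] {T : Finset α} {m : ℕ} (h : #T ≤ m) :
    ∃ u : Fin m → α, T ⊆ univ.image u := by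
  classical
  -- The list of points of `T` is padded with an arbitrary point, since only an inclusion is needed.
  refine ⟨fun k => if hk : (k : ℕ) < #T then T.equivFin.symm ⟨k, hk⟩ else Classical.arbitrary α,
    fun x hx => mem_image.2 ⟨⟨T.equivFin ⟨x, hx⟩, (T.equivFin ⟨x, hx⟩).2.trans_le h⟩,
      mem_univ _, ?_⟩⟩
  simp

/-- Tuples of permutations moving together at most `m` points. -/
lemma card_le_of_card_biUnion_support_le [Nonempty α] {κ : Type} [Fintype κ] [DecidableEq κ]
    {m : ℕ} (S : Finset (κ → Perm α))
    (hS : ∀ t ∈ S, #(univ.biUnion fun j => (t j).support) ≤ m) :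
    #S ≤ (m !) ^ Fintype.card κ * Fintype.card α ^ m := by
  -- Choose `m` points containing all supports, in at most `|α| ^ m` ways; each permutation then
  -- lives on them, leaving at most `m!` choices.
  have hsub : S ⊆ (univ : Finset (Fin m → α)).biUnion fun u =>
      Fintype.piFinset fun _ : κ => ({g | g.support ⊆ univ.image u} : Finset (Perm α)) := by
    intro t ht
    obtain ⟨u, hu⟩ := exists_subset_image (hS t ht)
    simp only [mem_biUnion, mem_univ, true_and, Fintype.mem_piFinset, mem_filter]
    exact ⟨u, fun j => (subset_biUnion_of_mem (fun j => (t j).support) (mem_univ j)).trans hu⟩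
  refine (card_le_card hsub).trans ((card_biUnion_le_card_mul _ _ ((m !) ^ Fintype.card κ)
    fun u _ => ?_).trans_eq ?_)
  · rw [Fintype.card_piFinset, prod_const, card_univ, card_support_subset]
    refine Nat.pow_le_pow_left (Nat.factorial_le ?_) _
    exact card_image_le.trans_eq (by simp)
  · simp [mul_comm]

/-- The cycles of length `i`. -/
def cycles (α : Type) [Fintype α] [DecidableEq α] (i : ℕ) : Finset (Perm α) :=
  {g | g.cycleType = {i}}

lemma mem_cycles {i : ℕ} {g : Perm α} : g ∈ cycles α i ↔ g.cycleType = {i} := by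
  simp [cycles]

lemma isCycle_of_mem_cycles {i : ℕ} {g : Perm α} (hg : g ∈ cycles α i) : g.IsCycle := by
  rw [← card_cycleType_eq_one, mem_cycles.1 hg, Multiset.card_singleton]

lemma card_support_of_mem_cycles {i : ℕ} {g : Perm α} (hg : g ∈ cycles α i) :
    #g.support = i := by
  rw [← sum_cycleType, mem_cycles.1 hg, Multiset.sum_singleton]

/-- With `n` points, `n ≤ i (n + 1 - i)`, and `(n + 1 - i) ^ i` is at most the falling factorial,
which is `i` times the number of cycles. -/
lemma pow_le_card_cycles {i : ℕ} (hi : 2 ≤ i) (h : i ≤ Fintype.card α) :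
    Fintype.card α ^ i ≤ i ^ (i + 1) * #(cycles α i) := by
  rw [cycles, card_of_cycleType_singleton hi h]
  have h0 : Fintype.card α ≤ i * (Fintype.card α + 1 - i) := by
    obtain ⟨k, hk⟩ := Nat.exists_eq_add_of_le h
    rw [hk, show i + k + 1 - i = k + 1 by omega]
    nlinarith
  have h1 : (Fintype.card α + 1 - i) ^ i ≤ i ! * (Fintype.card α).choose i := by
    rw [← Nat.descFactorial_eq_factorial_mul_choose]
    exact Nat.pow_sub_le_descFactorial _ _
  refine (Nat.pow_le_pow_left h0 i).trans ?_
  rw [mul_pow, pow_succ, mul_assoc, ← mul_assoc i, Nat.mul_factorial_pred (by omega)]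
  exact Nat.mul_le_mul_left _ h1

/-- The number of factorizations of `g` into two cycles of length `i`. -/
def factorizations (i : ℕ) (g : Perm α) : ℕ :=
  #{q ∈ cycles α i ×ˢ cycles α i | q.1 * q.2 = g}

lemma sum_factorizations (i : ℕ) (S : Finset (Perm α)) :
    ∑ g ∈ S, factorizations i g = #{q ∈ cycles α i ×ˢ cycles α i | q.1 * q.2 ∈ S} := by
  rw [card_eq_sum_card_fiberwise (f := fun q => q.1 * q.2) (t := S)
    (by intro q hq; exact (mem_filter.1 hq).2)]
  refine sum_congr rfl fun g hg => ?_
  rw [factorizations, filter_filter]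
  congr 1
  ext q
  simp only [mem_filter, and_congr_right_iff]
  rintro -
  exact ⟨fun h => ⟨h ▸ hg, h⟩, fun h => h.2⟩

/-- Pairs of factorizations with the same product in `S`. -/
def quads (i : ℕ) (S : Finset (Perm α)) : Finset (Fin 4 → Perm α) :=
  {t | (∀ j, t j ∈ cycles α i) ∧ t 0 * t 1 = t 2 * t 3 ∧ t 0 * t 1 ∈ S}

lemma sum_factorizations_sq (i : ℕ) (S : Finset (Perm α)) :
    ∑ g ∈ S, factorizations i g ^ 2 = #(quads i S) := by
  rw [card_eq_sum_card_fiberwise (f := fun t => t 0 * t 1) (t := S)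
    (by intro q hq; exact (mem_filter.1 hq).2.2.2)]
  refine sum_congr rfl fun g hg => ?_
  rw [factorizations, sq, ← card_product]
  refine card_bij' (fun q _ => ![q.1.1, q.1.2, q.2.1, q.2.2])
    (fun t _ => ((t 0, t 1), (t 2, t 3))) ?_ ?_ ?_ ?_
  · rintro ⟨⟨a, b⟩, ⟨c, d⟩⟩ h
    simp only [mem_product, mem_filter] at h
    simp [quads, Fin.forall_fin_succ, h, hg]
  · intro t h
    simp only [quads, mem_filter, mem_univ, true_and] at h
    simp only [mem_product, mem_filter]
    exact ⟨⟨⟨h.1.1 0, h.1.1 1⟩, h.2⟩, ⟨h.1.1 2, h.1.1 3⟩, h.1.2.1 ▸ h.2⟩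
  · rintro ⟨⟨a, b⟩, ⟨c, d⟩⟩ h
    rfl
  · intro t h
    ext j : 1
    fin_cases j <;> rfl

/-- The number of permutations of a family that move a given point. -/
def movers (t : Fin 4 → Perm α) (x : α) : ℕ := #{j | x ∈ (t j).support}

lemma sum_movers (t : Fin 4 → Perm α) : ∑ x, movers t x = ∑ j, #(t j).support := by
  simp only [movers, card_filter]
  rw [sum_comm]
  refine sum_congr rfl fun j _ => ?_
  rw [← card_filter]
  congr 1
  ext
  simp

lemma movers_eq (t : Fin 4 → Perm α) (x : α) : movers t x =
    (if x ∈ (t 0).support then 1 else 0) + (if x ∈ (t 1).support then 1 else 0) +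
    (if x ∈ (t 2).support then 1 else 0) + (if x ∈ (t 3).support then 1 else 0) := by
  rw [movers, card_filter, Fin.sum_univ_four]

/-- If three of the four permutations fix `x`, the relation forces the fourth to fix it as well. -/
lemma two_le_movers {t : Fin 4 → Perm α} (h : t 0 * t 1 = t 2 * t 3) {x : α}
    (hx : x ∈ univ.biUnion fun j => (t j).support) : 2 ≤ movers t x := by
  have hx' : movers t x ≠ 0 := by
    rw [movers, card_ne_zero]
    obtain ⟨j, -, hj⟩ := mem_biUnion.1 hx
    exact ⟨j, by simpa using hj⟩
  have hxx : t 0 (t 1 x) = t 2 (t 3 x) := congrArg (fun g : Perm α => g x) h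
  rw [movers_eq] at hx' ⊢
  simp only [mem_support] at hx' ⊢
  by_cases h0 : t 0 x = x <;> by_cases h1 : t 1 x = x <;> by_cases h2 : t 2 x = x <;>
    by_cases h3 : t 3 x = x <;> simp [h0, h1, h2, h3] at hx' hxx ⊢
  · exact h3 ((t 2).injective (by rw [← hxx, h2]))
  · exact h2 hxx.symm
  · exact h1 ((t 0).injective (by rw [hxx, h0]))

lemma card_biUnion_eq_sum (t : Fin 4 → Perm α) : #(univ.biUnion fun j => (t j).support) =
    ∑ x, if x ∈ univ.biUnion (fun j => (t j).support) then 1 else 0 := by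
  rw [← card_filter]
  congr 1
  ext
  simp

lemma card_union_of_mem_quads {i : ℕ} {S : Finset (Perm α)} {t : Fin 4 → Perm α}
    (ht : t ∈ quads i S) : #(univ.biUnion fun j => (t j).support) ≤ 2 * i := by
  simp only [quads, mem_filter, mem_univ, true_and] at ht
  have h1 : ∑ x, movers t x = 4 * i := by
    rw [sum_movers]
    simp [fun j => card_support_of_mem_cycles (ht.1 j)]
  have h2 : 2 * #(univ.biUnion fun j => (t j).support) ≤ ∑ x, movers t x := by
    rw [card_biUnion_eq_sum, mul_sum]
    refine sum_le_sum fun x _ => ?_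
    split_ifs with hx
    · exact two_le_movers ht.2.1 hx
    · simp
  omega

lemma card_support_mul_of_mem_cycles {i : ℕ} {a b : Perm α} (ha : a ∈ cycles α i)
    (hb : b ∈ cycles α i) : #(a * b).support ≤ 2 * i := by
  have h1 := card_le_card (support_mul_le a b)
  have h2 := card_union_le a.support b.support
  rw [card_support_of_mem_cycles ha, card_support_of_mem_cycles hb] at h2
  exact h1.trans (h2.trans_eq (two_mul i).symm)

lemma disjoint_iff_card_support_mul {i : ℕ} {a b : Perm α} (ha : a ∈ cycles α i)
    (hb : b ∈ cycles α i) : Perm.Disjoint a b ↔ #(a * b).support = 2 * i := by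
  constructor
  · intro h
    rw [h.card_support_mul, card_support_of_mem_cycles ha, card_support_of_mem_cycles hb, two_mul]
  · intro h
    rw [disjoint_iff_disjoint_support, ← card_union_eq_card_add_card]
    have h1 := card_le_card (support_mul_le a b)
    have h2 := card_union_le a.support b.support
    rw [card_support_of_mem_cycles ha, card_support_of_mem_cycles hb] at h2 ⊢
    change _ ≤ #(a.support ∪ b.support) at h1
    omega

/-- For `y` in both supports, `a (b y) = y ≠ b y`, so `b y` is again in both. The single cycle of
`b` thus stays in the support of `a`, and the supports coincide by cardinality. -/
lemma mul_eq_one_of_fixes_inter {i : ℕ} {a b : Perm α} (ha : a ∈ cycles α i)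
    (hb : b ∈ cycles α i) (hab : ¬ Perm.Disjoint a b)
    (h : ∀ x ∈ a.support, x ∈ b.support → a (b x) = x) : a * b = 1 := by
  obtain ⟨x, hx⟩ : ∃ x, x ∈ a.support ∧ x ∈ b.support := by
    rw [disjoint_iff_disjoint_support, not_disjoint_iff] at hab
    exact hab
  have hstep : ∀ y, y ∈ a.support ∧ y ∈ b.support → b y ∈ a.support ∧ b y ∈ b.support := by
    rintro y ⟨h1, h2⟩
    refine ⟨?_, apply_mem_support.2 h2⟩
    rw [mem_support, h y h1 h2]
    exact (mem_support.1 h2).symm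
  have hpow : ∀ k : ℕ, (b ^ k) x ∈ a.support ∧ (b ^ k) x ∈ b.support := by
    intro k
    induction k with
    | zero => simpa using hx
    | succ k ih =>
      rw [pow_succ', Perm.mul_apply]
      exact hstep _ ih
  have hsub : b.support ⊆ a.support := by
    intro y hy
    obtain ⟨k, hk⟩ := (isCycle_of_mem_cycles hb).exists_pow_eq (mem_support.1 hx.2)
      (mem_support.1 hy)
    exact hk ▸ (hpow k).1
  have heq : b.support = a.support := eq_of_subset_of_card_le hsub (by
    rw [card_support_of_mem_cycles ha, card_support_of_mem_cycles hb])
  ext y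
  by_cases hy : y ∈ b.support
  · exact h y (hsub hy) hy
  · have hy' := heq ▸ hy
    rw [notMem_support] at hy hy'
    simp [hy, hy']

/-- The supports have total size `4 * i` and cover each moved point at least twice. Were every moved
point covered exactly twice, a point common to the first two supports would be fixed by the last
two, hence by the product, and `mul_eq_one_of_fixes_inter` would make the product trivial. -/
lemma card_union_lt_of_mem_quads {i : ℕ} {S : Finset (Perm α)}
    (hS : ∀ g ∈ S, g ≠ 1 ∧ #g.support ≠ 2 * i) {t : Fin 4 → Perm α}
    (ht : t ∈ quads i S) : #(univ.biUnion fun j => (t j).support) ≤ 2 * i - 1 := by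
  simp only [quads, mem_filter, mem_univ, true_and] at ht
  have h1 : ∑ x, movers t x = 4 * i := by
    rw [sum_movers]
    simp [fun j => card_support_of_mem_cycles (ht.1 j)]
  have h2 : 2 * #(univ.biUnion fun j => (t j).support) < ∑ x, movers t x := by
    rw [card_biUnion_eq_sum, mul_sum]
    have hle : ∀ x ∈ (univ : Finset α),
        (2 * if x ∈ univ.biUnion (fun j => (t j).support) then 1 else 0) ≤ movers t x := by
      intro x _
      split_ifs with hx
      · exact two_le_movers ht.2.1 hx
      · simp
    refine sum_lt_sum hle ?_
    by_contra! hcon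
    refine (hS _ ht.2.2).1 (mul_eq_one_of_fixes_inter (ht.1 0) (ht.1 1) ?_ fun x h0 h1 => ?_)
    · rw [disjoint_iff_card_support_mul (ht.1 0) (ht.1 1)]
      exact (hS _ ht.2.2).2
    · have hm := hcon x (mem_univ _)
      have hm2 : movers t x ≤ 2 := hm.trans (by split_ifs <;> simp)
      rw [movers_eq] at hm2
      have h2 : x ∉ (t 2).support := fun h2 => by
        rw [if_pos h0, if_pos h1, if_pos h2] at hm2
        omega
      have h3 : x ∉ (t 3).support := fun h3 => by
        rw [if_pos h0, if_pos h1, if_pos h3] at hm2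
        omega
      rw [notMem_support] at h2 h3
      have hxx : t 0 (t 1 x) = t 2 (t 3 x) := congrArg (fun g : Perm α => g x) ht.2.1
      rw [hxx, h3, h2]
  omega

lemma sum_factorizations_sq_le [Nonempty α] (i : ℕ) :
    ∑ g : Perm α, factorizations i g ^ 2 ≤ (2 * i)! ^ 4 * Fintype.card α ^ (2 * i) := by
  rw [sum_factorizations_sq]
  exact card_le_of_card_biUnion_support_le _ fun t ht => card_union_of_mem_quads ht

lemma sum_factorizations_sq_le_of_overlap [Nonempty α] (i : ℕ) :
    ∑ g : Perm α with g ≠ 1 ∧ #g.support ≠ 2 * i, factorizations i g ^ 2 ≤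
      (2 * i)! ^ 4 * Fintype.card α ^ (2 * i - 1) := by
  rw [sum_factorizations_sq]
  refine (card_le_of_card_biUnion_support_le (m := 2 * i - 1) _ fun t ht =>
    card_union_lt_of_mem_quads (fun g hg => (mem_filter.1 hg).2) ht).trans ?_
  rw [Fintype.card_fin]
  exact Nat.mul_le_mul_right _ (Nat.pow_le_pow_left (Nat.factorial_le (Nat.sub_le _ _)) _)

lemma sum_factorizations_le_of_overlap [Nonempty α] {i : ℕ} :
    ∑ g : Perm α with #g.support ≠ 2 * i, factorizations i g ≤
      (2 * i)! ^ 4 * Fintype.card α ^ (2 * i - 1) := by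
  rw [sum_factorizations]
  have h1 : #{q ∈ cycles α i ×ˢ cycles α i |
      q.1 * q.2 ∈ ({g | #g.support ≠ 2 * i} : Finset (Perm α))} =
      #(({q ∈ cycles α i ×ˢ cycles α i |
      q.1 * q.2 ∈ ({g | #g.support ≠ 2 * i} : Finset (Perm α))}).image
        fun q => (![q.1, q.2] : Fin 2 → Perm α)) := by
    refine (card_image_of_injective _ ?_).symm
    rintro ⟨a, b⟩ ⟨c, d⟩ h
    have h0 := congrFun h 0
    have h1 := congrFun h 1
    simp at h0 h1
    rw [h0, h1]
  rw [h1]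
  refine (card_le_of_card_biUnion_support_le (m := 2 * i - 1) _ fun t ht => ?_).trans ?_
  · obtain ⟨⟨a, b⟩, hq, rfl⟩ := mem_image.1 ht
    simp only [mem_filter, mem_product, mem_univ, true_and] at hq
    have hU : (univ.biUnion fun j : Fin 2 => ((![a, b] : Fin 2 → Perm α) j).support) =
        a.support ∪ b.support := by
      ext x
      simp [Fin.exists_fin_two]
    have h2 := card_union_le a.support b.support
    rw [card_support_of_mem_cycles hq.1.1, card_support_of_mem_cycles hq.1.2] at h2
    have h3 : #(a.support ∪ b.support) ≠ 2 * i := by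
      intro h
      apply hq.2
      rw [← disjoint_iff_card_support_mul hq.1.1 hq.1.2, disjoint_iff_disjoint_support,
        ← card_union_eq_card_add_card, h, card_support_of_mem_cycles hq.1.1,
        card_support_of_mem_cycles hq.1.2, two_mul]
    rw [hU]
    omega
  · rw [Fintype.card_fin]
    refine Nat.mul_le_mul_right _ ?_
    exact (Nat.pow_le_pow_left (Nat.factorial_le (Nat.sub_le _ _)) _).trans
      (Nat.pow_le_pow_right (Nat.factorial_pos _) (by norm_num))

lemma sum_factorizations_univ (i : ℕ) :
    ∑ g : Perm α, factorizations i g = #(cycles α i) ^ 2 := by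
  rw [sum_factorizations]
  simp [sq]

lemma card_support_le_of_factorizations_ne_zero {i : ℕ} {g : Perm α}
    (h : factorizations i g ≠ 0) : #g.support ≤ 2 * i := by
  rw [factorizations, card_ne_zero] at h
  obtain ⟨⟨a, b⟩, hq⟩ := h
  simp only [mem_filter, mem_product] at hq
  exact hq.2 ▸ card_support_mul_of_mem_cycles hq.1.1 hq.1.2

/-- Full support forces disjoint, hence commuting and distinct, factors; swapping them gives a
second factorization. -/
lemma two_mul_factorizations_le {i : ℕ} (hi : i ≠ 0) {g : Perm α} (hg : #g.support = 2 * i) :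
    2 * factorizations i g ≤ factorizations i g ^ 2 := by
  rcases Nat.eq_zero_or_pos (factorizations i g) with h0 | hpos
  · simp [h0]
  rw [sq]
  refine Nat.mul_le_mul_right _ ?_
  obtain ⟨⟨a, b⟩, hq⟩ := card_pos.1 hpos
  simp only [mem_filter, mem_product] at hq
  have hd : Perm.Disjoint a b := (disjoint_iff_card_support_mul hq.1.1 hq.1.2).2 (hq.2 ▸ hg)
  have hne : a ≠ b := by
    rintro rfl
    have := card_support_of_mem_cycles hq.1.1
    rw [disjoint_refl_iff.1 hd] at this
    simp at this
    exact hi this.symm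
  rw [factorizations, Nat.succ_le_iff, one_lt_card]
  refine ⟨(a, b), ?_, (b, a), ?_, fun h => hne (congrArg Prod.fst h)⟩
  · simpa using hq
  · simpa [← hd.commute.eq] using ⟨hq.1.symm, hq.2⟩

/-- This lower bound supplies the negative term that cancels the contribution of the identity in the
fourth moment. -/
lemma two_mul_sq_card_cycles_le [Nonempty α] {i : ℕ} (hi : i ≠ 0) :
    2 * #(cycles α i) ^ 2 ≤ ∑ g : Perm α with #g.support = 2 * i, factorizations i g ^ 2 +
      2 * ((2 * i)! ^ 4 * Fintype.card α ^ (2 * i - 1)) := by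
  rw [← sum_factorizations_univ, ← sum_filter_add_sum_filter_not univ
    (fun g : Perm α => #g.support = 2 * i), mul_add, mul_sum]
  refine add_le_add (sum_le_sum fun g hg => two_mul_factorizations_le hi (mem_filter.1 hg).2) ?_
  exact Nat.mul_le_mul_left _ sum_factorizations_le_of_overlap

lemma inv_mem_cycles {i : ℕ} {g : Perm α} (hg : g ∈ cycles α i) : g⁻¹ ∈ cycles α i := by
  rw [mem_cycles, cycleType_inv, ← mem_cycles]
  exact hg

lemma factorizations_eq (i : ℕ) (g : Perm α) :
    factorizations i g = #{x ∈ cycles α i | x⁻¹ * g ∈ cycles α i} := by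
  refine card_bij' (fun q _ => q.1) (fun x _ => (x, x⁻¹ * g)) ?_ ?_ ?_ ?_
  · rintro ⟨a, b⟩ h
    simp only [mem_filter, mem_product] at h ⊢
    rw [← h.2]
    simpa using h.1
  · intro x h
    simpa using h
  · rintro ⟨a, b⟩ h
    simp only [mem_filter, mem_product] at h
    simp [← h.2]
  · simp

lemma factorizations_one (i : ℕ) : factorizations i (1 : Perm α) = #(cycles α i) := by
  rw [factorizations_eq, filter_true_of_mem]
  intro x hx
  rw [mul_one]
  exact inv_mem_cycles hx

end CycleCount

/-! ### The character ratio as a scalar of the class sum of cycles. -/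

namespace Irr

open Finset Equiv CycleCount
open scoped Nat

variable {n : ℕ}

lemma isSymmClass_of_cycleType {f : Perm (Fin n) → ℝ} (F : Multiset ℕ → ℝ)
    (h : ∀ g, f g = F g.cycleType) : IsSymmClass f := by
  refine IsSymmClass.of_isConj (fun g k hgk => ?_) fun g => ?_
  · rw [h, h, Perm.isConj_iff_cycleType_eq.1 hgk]
  · rw [Perm.isConj_iff_cycleType_eq, Perm.cycleType_inv]

/-- The indicator function of the cycles of length `i`. -/
def cycleIndicator (n i : ℕ) (g : Perm (Fin n)) : ℝ := if g ∈ cycles (Fin n) i then 1 else 0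

/-- The proportion of fixed points of a permutation. -/
def fixedRatio (n : ℕ) (g : Perm (Fin n)) : ℝ := 1 - (#g.support : ℝ) / n

lemma isSymmClass_cycleIndicator (n i : ℕ) : IsSymmClass (cycleIndicator n i) :=
  isSymmClass_of_cycleType (fun s => if s = {i} then 1 else 0) fun g => by
    simp [cycleIndicator, mem_cycles]

lemma isSymmClass_fixedRatio (n : ℕ) : IsSymmClass (fixedRatio n) :=
  isSymmClass_of_cycleType (fun s => 1 - (s.sum : ℝ) / n) fun g => by
    rw [fixedRatio, Perm.sum_cycleType]

lemma groupConv_cycleIndicator (n i : ℕ) :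
    groupConv (cycleIndicator n i) (cycleIndicator n i) = fun g => (factorizations i g : ℝ) := by
  ext g
  rw [factorizations_eq, card_filter, Nat.cast_sum]
  simp only [groupConv, cycleIndicator, ite_mul, one_mul, zero_mul, ← sum_filter,
    filter_mem_eq_inter, univ_inter]
  simp

lemma isSymmClass_factorizations (n i : ℕ) :
    IsSymmClass fun g : Perm (Fin n) => (factorizations i g : ℝ) :=
  groupConv_cycleIndicator n i ▸
    (isSymmClass_cycleIndicator n i).groupConv (isSymmClass_cycleIndicator n i)

lemma kernel_fixedRatio_nonneg (hn : n ≠ 0) (l m : Irr (Perm (Fin n))) :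
    0 ≤ kernel (fixedRatio n) l m := by
  refine kernel_nonneg (fun j : Fin n => MulAction.stabilizer (Perm (Fin n)) j)
    (a := (n : ℝ)⁻¹) (by positivity) (fun g => ?_) l m
  have h1 : Nat.card {j : Fin n // g ∈ MulAction.stabilizer (Perm (Fin n)) j} + #g.support = n := by
    rw [Nat.card_eq_fintype_card, Fintype.card_subtype]
    have := card_filter_add_card_filter_not (s := (univ : Finset (Fin n))) (fun j => g j = j)
    rw [card_univ, Fintype.card_fin] at this
    exact this
  have h2 : (Nat.card {j : Fin n // g ∈ MulAction.stabilizer (Perm (Fin n)) j} : ℝ) =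
      n - #g.support := by
    rw [eq_sub_iff_add_eq]
    exact_mod_cast h1
  have hn' : (n : ℝ) ≠ 0 := by exact_mod_cast hn
  rw [h2, fixedRatio]
  field_simp

lemma fixedRatio_one (n : ℕ) : fixedRatio n 1 = 1 := by simp [fixedRatio]

/-- The normalized eigenvalue of the sum of all `i`-cycles. -/
def cycleStat (n i : ℕ) (l : Irr (Perm (Fin n))) : ℝ :=
  hat (cycleIndicator n i) l / √(#(cycles (Fin n) i) : ℝ)

lemma cycleRatio_eq_cycleStat {i : ℕ} (hi : 2 ≤ i) {c : Perm (Fin n)} (hc : c.IsCycle)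
    (hci : #c.support = i) (l : Irr (Perm (Fin n))) : cycleRatio i c l = cycleStat n i l := by
  have hin : i ≤ Fintype.card (Fin n) := hci ▸ card_le_univ _
  have hcard : (#(cycles (Fin n) i) : ℝ) = (n.choose i : ℝ) * ((i - 1)! : ℝ) := by
    rw [cycles, Perm.card_of_cycleType_singleton hi hin, Fintype.card_fin, mul_comm]
    push_cast
    rfl
  have hcm : c ∈ cycles (Fin n) i := by rw [mem_cycles, hc.cycleType, hci]
  have hpos : 0 < (#(cycles (Fin n) i) : ℝ) := by exact_mod_cast card_pos.2 ⟨c, hcm⟩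
  have hsum : ∑ g, (cycleIndicator n i g : ℂ) * l.character g =
      (#(cycles (Fin n) i) : ℂ) * l.character c := by
    simp only [cycleIndicator]
    rw [← nsmul_eq_mul, ← sum_const]
    have : ∀ g : Perm (Fin n), (((if g ∈ cycles (Fin n) i then 1 else 0 : ℝ)) : ℂ) *
        l.character g = if g ∈ cycles (Fin n) i then l.character g else 0 := by
      intro g
      split_ifs <;> simp
    simp only [this, ← sum_filter, filter_mem_eq_inter, univ_inter]
    refine sum_congr rfl fun g hg => ?_
    obtain ⟨k, rfl⟩ := isConj_iff.1 (Perm.isConj_iff_cycleType_eq.2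
      ((mem_cycles.1 hcm).trans (mem_cycles.1 hg).symm))
    exact l.character_conj _ _
  have hs : √(#(cycles (Fin n) i) : ℝ) ≠ 0 := (Real.sqrt_pos.2 hpos).ne'
  rw [cycleRatio, cycleStat, hat, hsum, ← hcard, div_right_comm]
  congr 1
  rw [eq_div_iff hs, ← Complex.ofReal_natCast, Complex.re_ofReal_mul]
  nth_rewrite 3 [← Real.mul_self_sqrt hpos.le]
  ring

/-- The constant in the bounds for the numbers of factorizations. -/
def countBound (i : ℕ) : ℝ := (i : ℝ) ^ (2 * i + 2) * ((2 * i)! : ℝ) ^ 4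

lemma countBound_nonneg (i : ℕ) : 0 ≤ countBound i := by
  unfold countBound
  positivity

/-! ### Factorization counts measured against the square of the class size. -/

section Counts

variable {i : ℕ} (hi : 2 ≤ i) (hin : i ≤ n)

include hi hin

lemma factorial_mul_pow_le :
    ((2 * i)! : ℝ) ^ 4 * (n : ℝ) ^ (2 * i) ≤ countBound i * (#(cycles (Fin n) i) : ℝ) ^ 2 := by
  have h := pow_le_card_cycles (α := Fin n) hi (by simpa using hin)
  rw [Fintype.card_fin] at h
  have h1 : (n : ℝ) ^ i ≤ (i : ℝ) ^ (i + 1) * #(cycles (Fin n) i) := by exact_mod_cast h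
  have h2 := pow_le_pow_left₀ (by positivity) h1 2
  rw [← pow_mul, mul_pow, ← pow_mul, mul_comm i 2, show (i + 1) * 2 = 2 * i + 2 by ring] at h2
  rw [countBound]
  nlinarith [mul_le_mul_of_nonneg_left h2 (by positivity : (0 : ℝ) ≤ ((2 * i)! : ℝ) ^ 4)]

lemma factorial_mul_pow_pred_le :
    ((2 * i)! : ℝ) ^ 4 * (n : ℝ) ^ (2 * i - 1) ≤
      countBound i * (#(cycles (Fin n) i) : ℝ) ^ 2 / n := by
  have hn : (0 : ℝ) < n := by exact_mod_cast (by omega : 0 < n)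
  rw [le_div_iff₀ hn, mul_assoc, ← pow_succ, show 2 * i - 1 + 1 = 2 * i by omega]
  exact factorial_mul_pow_le hi hin

lemma sum_factorizations_sq_le_real : ∑ g : Perm (Fin n), (factorizations i g : ℝ) ^ 2 ≤
    countBound i * (#(cycles (Fin n) i) : ℝ) ^ 2 := by
  have : Nonempty (Fin n) := ⟨⟨0, by omega⟩⟩
  refine le_trans ?_ (factorial_mul_pow_le hi hin)
  have h := sum_factorizations_sq_le (α := Fin n) i
  rw [Fintype.card_fin] at h
  exact_mod_cast h

lemma sum_factorizations_sq_overlap_le_real :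
    ∑ g : Perm (Fin n) with g ≠ 1 ∧ #g.support ≠ 2 * i, (factorizations i g : ℝ) ^ 2 ≤
      countBound i * (#(cycles (Fin n) i) : ℝ) ^ 2 / n := by
  have : Nonempty (Fin n) := ⟨⟨0, by omega⟩⟩
  refine le_trans ?_ (factorial_mul_pow_pred_le hi hin)
  have h := sum_factorizations_sq_le_of_overlap (α := Fin n) i
  rw [Fintype.card_fin] at h
  exact_mod_cast h

lemma le_sum_factorizations_sq_disjoint_real : 2 * (#(cycles (Fin n) i) : ℝ) ^ 2 -
    2 * (countBound i * (#(cycles (Fin n) i) : ℝ) ^ 2 / n) ≤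
      ∑ g : Perm (Fin n) with #g.support = 2 * i, (factorizations i g : ℝ) ^ 2 := by
  have : Nonempty (Fin n) := ⟨⟨0, by omega⟩⟩
  have h := two_mul_sq_card_cycles_le (α := Fin n) (i := i) (by omega)
  rw [Fintype.card_fin] at h
  have h1 : 2 * (#(cycles (Fin n) i) : ℝ) ^ 2 ≤
      ∑ g : Perm (Fin n) with #g.support = 2 * i, (factorizations i g : ℝ) ^ 2 +
        2 * (((2 * i)! : ℝ) ^ 4 * (n : ℝ) ^ (2 * i - 1)) := by exact_mod_cast h
  linarith [factorial_mul_pow_pred_le hi hin]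

lemma card_cycles_pos : 0 < (#(cycles (Fin n) i) : ℝ) := by
  have h := pow_le_card_cycles (α := Fin n) hi (by simpa using hin)
  rw [Fintype.card_fin] at h
  have h1 : 0 < n ^ i := by
    have : 0 < n := by omega
    positivity
  exact_mod_cast Nat.pos_of_mul_pos_left (h1.trans_le h)

/-- The quantity controlling the fourth moment of the increments. -/
lemma sum_factorizations_sq_mul_le :
    ∑ g : Perm (Fin n), (factorizations i g : ℝ) ^ 2 * (8 * i - 6 * #g.support) ≤
      16 * i * (countBound i * (#(cycles (Fin n) i) : ℝ) ^ 2 / n) := by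
  -- The weight is `8i` at the identity, `-4i` at support size `2i`, and at most `8i` elsewhere. The
  -- identity contributes `8i|C|²`, which the disjoint products cancel up to an error; that error
  -- and the overlap term are `8i` times the overlap bound each.
  have hpt : ∀ g : Perm (Fin n), (factorizations i g : ℝ) ^ 2 * (8 * i - 6 * #g.support) ≤
      (if g = 1 then 8 * i * (factorizations i g : ℝ) ^ 2 else 0) +
      (if #g.support = 2 * i then -(4 * i) * (factorizations i g : ℝ) ^ 2 else 0) +
      if g ≠ 1 ∧ #g.support ≠ 2 * i then 8 * i * (factorizations i g : ℝ) ^ 2 else 0 := by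
    intro g
    by_cases hg : g = 1
    · subst hg
      have : (0 : ℕ) ≠ 2 * i := by omega
      simp [this]
      linarith
    · by_cases hs : #g.support = 2 * i
      · simp [hg, hs]
        linarith
      · simp only [hg, hs, if_false, ne_eq, not_false_eq_true, and_self, if_true, zero_add]
        have : (0 : ℝ) ≤ #g.support := by positivity
        nlinarith [sq_nonneg (factorizations i g : ℝ)]
  refine (sum_le_sum fun g _ => hpt g).trans ?_
  rw [sum_add_distrib, sum_add_distrib, ← sum_filter, ← sum_filter, ← sum_filter, ← mul_sum,
    ← mul_sum, ← mul_sum, sum_filter, sum_ite_eq' univ (1 : Perm (Fin n)), if_pos (mem_univ _),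
    factorizations_one]
  have h1 := sum_factorizations_sq_overlap_le_real hi hin
  have h2 := le_sum_factorizations_sq_disjoint_real hi hin
  have hi0 : (0 : ℝ) ≤ i := by positivity
  nlinarith [mul_le_mul_of_nonneg_left h1 hi0, mul_le_mul_of_nonneg_left h2 hi0]

end Counts

/-! ### Moments of the increments of the chain. -/

section Moments

variable {i : ℕ}

lemma cycleStat_sq (l : Irr (Perm (Fin n))) : cycleStat n i l ^ 2 =
    (#(cycles (Fin n) i) : ℝ)⁻¹ * hat (fun g => (factorizations i g : ℝ)) l := by
  rw [cycleStat, div_pow, Real.sq_sqrt (by positivity), ← groupConv_cycleIndicator,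
    hat_groupConv (isSymmClass_cycleIndicator n i) (isSymmClass_cycleIndicator n i)]
  ring

/-- `fixedRatio` is constant on `i`-cycles, so the statistic is an eigenfunction of the chain. -/
lemma sum_kernel_mul_cycleStat (l : Irr (Perm (Fin n))) :
    ∑ m, kernel (fixedRatio n) l m * cycleStat n i m =
      l.weight * ((1 - (i : ℝ) / n) * cycleStat n i l) := by
  have h := sum_kernel_mul_hat (fixedRatio n) (isSymmClass_cycleIndicator n i) l
  have h1 : (fun g => fixedRatio n g * cycleIndicator n i g) =
      fun g => (1 - (i : ℝ) / n) * cycleIndicator n i g := by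
    ext g
    rw [cycleIndicator]
    split_ifs with hg
    · rw [fixedRatio, card_support_of_mem_cycles hg]
    · simp
  rw [h1, hat_const_mul] at h
  simp only [cycleStat, mul_div_assoc', ← sum_div]
  rw [h]

/-- The class function whose eigenvalue is the conditional second moment of the increment. -/
def stepFun (n i : ℕ) (g : Perm (Fin n)) : ℝ :=
  (#(cycles (Fin n) i) : ℝ)⁻¹ * ((2 * i - #g.support) / n * factorizations i g)

lemma isSymmClass_stepFun (n i : ℕ) : IsSymmClass (stepFun n i) := by
  have h1 : IsSymmClass fun g : Perm (Fin n) =>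
      (#(cycles (Fin n) i) : ℝ)⁻¹ * ((2 * i - #g.support) / n) :=
    isSymmClass_of_cycleType
      (fun s => (#(cycles (Fin n) i) : ℝ)⁻¹ * ((2 * i - (s.sum : ℝ)) / n)) fun g => by
        rw [Perm.sum_cycleType]
  have h2 := h1.mul (isSymmClass_factorizations n i)
  simp only [mul_assoc] at h2
  exact h2

lemma sum_weight_mul_hat_stepFun_mul_cycleStat_sq :
    ∑ l : Irr (Perm (Fin n)), l.weight * (hat (stepFun n i) l * cycleStat n i l ^ 2) =
      ((#(cycles (Fin n) i) : ℝ) ^ 2)⁻¹ *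
        ∑ g : Perm (Fin n), (factorizations i g : ℝ) ^ 2 * ((2 * i - #g.support) / n) := by
  simp only [cycleStat_sq, mul_left_comm _ (#(cycles (Fin n) i) : ℝ)⁻¹, ← mul_sum]
  rw [sum_weight_mul_hat_mul_hat (isSymmClass_stepFun n i) (isSymmClass_factorizations n i),
    mul_sum, mul_sum]
  refine sum_congr rfl fun g _ => ?_
  rw [stepFun]
  ring

lemma sum_weight_mul_cycleStat_pow_four :
    ∑ l : Irr (Perm (Fin n)), l.weight * (cycleStat n i l ^ 2 * cycleStat n i l ^ 2) =
      ((#(cycles (Fin n) i) : ℝ) ^ 2)⁻¹ *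
        ∑ g : Perm (Fin n), (factorizations i g : ℝ) ^ 2 := by
  have := sum_weight_mul_hat_mul_hat (isSymmClass_factorizations n i)
    (isSymmClass_factorizations n i)
  simp only [← sq (factorizations i _ : ℝ)] at this
  rw [← this, mul_sum]
  refine sum_congr rfl fun g _ => ?_
  rw [cycleStat_sq]
  ring

variable (hn : n ≠ 0)

include hn

lemma stepFun_eq (g : Perm (Fin n)) : stepFun n i g = (#(cycles (Fin n) i) : ℝ)⁻¹ *
    (fixedRatio n g * factorizations i g + (2 * ((i : ℝ) / n) - 1) * factorizations i g) := by
  have hn' : (n : ℝ) ≠ 0 := by exact_mod_cast hn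
  rw [stepFun, fixedRatio]
  field_simp
  ring

lemma sum_kernel_mul_cycleStat_sq (l : Irr (Perm (Fin n))) :
    ∑ m, kernel (fixedRatio n) l m * cycleStat n i m ^ 2 = l.weight *
      (hat (stepFun n i) l + (1 - 2 * ((i : ℝ) / n)) * cycleStat n i l ^ 2) := by
  have h := sum_kernel_mul_hat (fixedRatio n) (isSymmClass_factorizations n i) l
  have h1 : hat (stepFun n i) l = (#(cycles (Fin n) i) : ℝ)⁻¹ *
      (hat (fun g => fixedRatio n g * factorizations i g) l +
        (2 * ((i : ℝ) / n) - 1) * hat (fun g => (factorizations i g : ℝ)) l) := by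
    rw [← hat_const_mul, ← hat_add, ← hat_const_mul]
    congr 1
    ext g
    exact stepFun_eq hn g
  simp only [cycleStat_sq, mul_left_comm _ (#(cycles (Fin n) i) : ℝ)⁻¹, ← mul_sum]
  rw [h, h1]
  ring

lemma sum_kernel_mul_sq_sub (l : Irr (Perm (Fin n))) :
    ∑ m, kernel (fixedRatio n) l m * (cycleStat n i m - cycleStat n i l) ^ 2 =
      l.weight * hat (stepFun n i) l := by
  have h0 := sum_kernel (fixedRatio_one n) l
  have h1 := sum_kernel_mul_cycleStat (i := i) l
  have h2 := sum_kernel_mul_cycleStat_sq (i := i) hn l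
  have : ∀ m, kernel (fixedRatio n) l m * (cycleStat n i m - cycleStat n i l) ^ 2 =
      kernel (fixedRatio n) l m * cycleStat n i m ^ 2 -
      2 * cycleStat n i l * (kernel (fixedRatio n) l m * cycleStat n i m) +
      cycleStat n i l ^ 2 * kernel (fixedRatio n) l m := fun m => by ring
  simp only [this, sum_add_distrib, sum_sub_distrib, ← mul_sum, h0, h1, h2]
  ring

/-- By symmetry E[W'⁴] = E[W⁴] and E[W'³ W] = (1 - i/n) E[W⁴], so only conditional moments of order
at most two are needed. -/
lemma sum_sum_kernel_mul_pow_four_sub :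
    ∑ l, ∑ m, kernel (fixedRatio n) l m * (cycleStat n i m - cycleStat n i l) ^ 4 =
      ∑ l : Irr (Perm (Fin n)), l.weight * (cycleStat n i l ^ 2 *
        (6 * hat (stepFun n i) l - 4 * ((i : ℝ) / n) * cycleStat n i l ^ 2)) := by
  have hsymm := fun l m => kernel_comm (isSymmClass_fixedRatio n).inv l m
  have h4 : ∑ l, ∑ m, kernel (fixedRatio n) l m * cycleStat n i m ^ 4 =
      ∑ l : Irr (Perm (Fin n)), l.weight * cycleStat n i l ^ 4 := by
    rw [sum_comm]
    refine sum_congr rfl fun l _ => ?_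
    rw [← sum_mul]
    simp only [hsymm _ l, sum_kernel (fixedRatio_one n)]
  have h31 : ∑ l, ∑ m, kernel (fixedRatio n) l m * (cycleStat n i m ^ 3 * cycleStat n i l) =
      ∑ l : Irr (Perm (Fin n)), l.weight * ((1 - (i : ℝ) / n) * cycleStat n i l ^ 4) := by
    rw [sum_comm]
    refine sum_congr rfl fun l _ => ?_
    simp only [hsymm _ l, mul_left_comm _ (cycleStat n i l ^ 3), ← mul_sum,
      sum_kernel_mul_cycleStat]
    ring
  have hexp : ∀ l, ∑ m, kernel (fixedRatio n) l m * (cycleStat n i m - cycleStat n i l) ^ 4 =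
      ∑ m, kernel (fixedRatio n) l m * cycleStat n i m ^ 4 -
      4 * ∑ m, kernel (fixedRatio n) l m * (cycleStat n i m ^ 3 * cycleStat n i l) +
      l.weight * (6 * cycleStat n i l ^ 2 *
        (hat (stepFun n i) l + (1 - 2 * ((i : ℝ) / n)) * cycleStat n i l ^ 2) -
        4 * ((1 - (i : ℝ) / n) * cycleStat n i l ^ 4) + cycleStat n i l ^ 4) := by
    intro l
    have h0 := sum_kernel (fixedRatio_one n) l
    have h1 := sum_kernel_mul_cycleStat (i := i) l
    have h2 := sum_kernel_mul_cycleStat_sq (i := i) hn l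
    have : ∀ m, kernel (fixedRatio n) l m * (cycleStat n i m - cycleStat n i l) ^ 4 =
        kernel (fixedRatio n) l m * cycleStat n i m ^ 4 -
        4 * (kernel (fixedRatio n) l m * (cycleStat n i m ^ 3 * cycleStat n i l)) +
        6 * cycleStat n i l ^ 2 * (kernel (fixedRatio n) l m * cycleStat n i m ^ 2) -
        4 * cycleStat n i l ^ 3 * (kernel (fixedRatio n) l m * cycleStat n i m) +
        cycleStat n i l ^ 4 * kernel (fixedRatio n) l m := fun m => by ring
    simp only [this, sum_add_distrib, sum_sub_distrib, ← mul_sum, h0, h1, h2]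
    ring
  simp only [hexp]
  rw [sum_add_distrib, sum_sub_distrib, ← mul_sum, h4, h31, mul_sum, ← sum_sub_distrib,
    ← sum_add_distrib]
  refine sum_congr rfl fun l _ => ?_
  ring

omit hn

variable (hi : 2 ≤ i) (hin : i ≤ n)

include hi hin

lemma sum_weight_mul_hat_stepFun :
    ∑ l : Irr (Perm (Fin n)), l.weight * hat (stepFun n i) l = 2 * ((i : ℝ) / n) := by
  have hC := (card_cycles_pos hi hin).ne'
  rw [sum_weight_mul_hat, stepFun, factorizations_one, Perm.support_one, card_empty]
  push_cast
  field_simp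
  ring

lemma sum_weight_mul_hat_stepFun_mul_cycleStat_sq_le :
    ∑ l : Irr (Perm (Fin n)), l.weight * (hat (stepFun n i) l * cycleStat n i l ^ 2) ≤
      2 * countBound i * ((i : ℝ) / n) := by
  have hC := card_cycles_pos hi hin
  have hn : (0 : ℝ) < n := by exact_mod_cast (by omega : 0 < n)
  rw [sum_weight_mul_hat_stepFun_mul_cycleStat_sq (n := n) (i := i), inv_mul_le_iff₀ (by positivity)]
  have h1 : ∑ g : Perm (Fin n), (factorizations i g : ℝ) ^ 2 * ((2 * i - #g.support) / n) ≤
      ∑ g : Perm (Fin n), (factorizations i g : ℝ) ^ 2 * (2 * ((i : ℝ) / n)) := by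
    refine sum_le_sum fun g _ => mul_le_mul_of_nonneg_left ?_ (sq_nonneg _)
    rw [mul_div_assoc']
    refine div_le_div_of_nonneg_right ?_ hn.le
    linarith [(Nat.cast_nonneg #g.support : (0 : ℝ) ≤ _)]
  rw [← sum_mul] at h1
  refine h1.trans ((mul_le_mul_of_nonneg_right (sum_factorizations_sq_le_real hi hin)
    (by positivity)).trans_eq ?_)
  ring

lemma sum_sum_kernel_mul_pow_four_sub_le :
    ∑ l, ∑ m, kernel (fixedRatio n) l m * (cycleStat n i m - cycleStat n i l) ^ 4 ≤
      16 * countBound i * ((i : ℝ) / n) * (n : ℝ)⁻¹ := by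
  have hC := card_cycles_pos hi hin
  have hn : (0 : ℝ) < n := by exact_mod_cast (by omega : 0 < n)
  have h1 : ∑ l : Irr (Perm (Fin n)), l.weight * (cycleStat n i l ^ 2 *
        (6 * hat (stepFun n i) l - 4 * ((i : ℝ) / n) * cycleStat n i l ^ 2)) =
      ((#(cycles (Fin n) i) : ℝ) ^ 2)⁻¹ * ((n : ℝ)⁻¹ *
        ∑ g : Perm (Fin n), (factorizations i g : ℝ) ^ 2 * (8 * i - 6 * #g.support)) := by
    have e1 := sum_weight_mul_hat_stepFun_mul_cycleStat_sq (n := n) (i := i)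
    have e2 := sum_weight_mul_cycleStat_pow_four (n := n) (i := i)
    have e3 : ∀ l : Irr (Perm (Fin n)), l.weight * (cycleStat n i l ^ 2 *
        (6 * hat (stepFun n i) l - 4 * ((i : ℝ) / n) * cycleStat n i l ^ 2)) =
        6 * (l.weight * (hat (stepFun n i) l * cycleStat n i l ^ 2)) -
        4 * ((i : ℝ) / n) * (l.weight * (cycleStat n i l ^ 2 * cycleStat n i l ^ 2)) :=
      fun l => by ring
    simp only [e3, sum_sub_distrib, ← mul_sum, e1, e2]
    simp only [mul_sum, ← sum_sub_distrib]
    refine sum_congr rfl fun g _ => ?_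
    field_simp
    ring
  rw [sum_sum_kernel_mul_pow_four_sub (by omega), h1, inv_mul_le_iff₀ (by positivity),
    inv_mul_le_iff₀ hn]
  refine (sum_factorizations_sq_mul_le hi hin).trans_eq ?_
  field_simp

lemma sum_weight_mul_sq_hat_stepFun_sub_le :
    ∑ l : Irr (Perm (Fin n)), l.weight * (hat (stepFun n i) l - 2 * ((i : ℝ) / n)) ^ 2 ≤
      4 * countBound i * ((i : ℝ) / n) ^ 2 * (n : ℝ)⁻¹ := by
  have hC := card_cycles_pos hi hin
  have hn : (0 : ℝ) < n := by exact_mod_cast (by omega : 0 < n)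
  -- Subtracting the mean removes the value at 1, and the factor `2i - #g.support` kills products of
  -- disjoint cycles. Only overlapping, nontrivial products survive.
  set u : Perm (Fin n) → ℝ := fun g =>
    stepFun n i g + -(2 * ((i : ℝ) / n)) * (if g = 1 then (1 : ℝ) else 0) with hu
  have hus : IsSymmClass u :=
    ⟨fun g h => by simp [hu, (isSymmClass_stepFun n i).conj],
      fun g => by simp [hu, (isSymmClass_stepFun n i).inv]⟩
  have hhat : ∀ l, hat (stepFun n i) l - 2 * ((i : ℝ) / n) = hat u l := by
    intro l
    rw [hu, hat_add, hat_const_mul, hat_indicator_one]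
    ring
  simp only [hhat, sq (hat u _)]
  rw [sum_weight_mul_hat_mul_hat hus hus]
  have hpt : ∀ g, u g * u g ≤ if g ≠ 1 ∧ #g.support ≠ 2 * i then
      ((#(cycles (Fin n) i) : ℝ) ^ 2)⁻¹ * (4 * ((i : ℝ) / n) ^ 2) *
        (factorizations i g : ℝ) ^ 2 else 0 := by
    intro g
    by_cases hg : g = 1
    · have : u g = 0 := by
        simp only [hu, hg, stepFun, factorizations_one, Perm.support_one, card_empty, if_true]
        push_cast
        field_simp
        ring
      rw [this, mul_zero, if_neg fun h => h.1 hg]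
    have hug : u g = stepFun n i g := by simp [hu, hg]
    by_cases hs : #g.support = 2 * i
    · simp [hug, stepFun, hs]
    rw [if_pos ⟨hg, hs⟩, hug, stepFun]
    by_cases h0 : factorizations i g = 0
    · simp [h0]
    have h1 : (#g.support : ℝ) ≤ 2 * i := by
      exact_mod_cast card_support_le_of_factorizations_ne_zero h0
    have h2 : (0 : ℝ) ≤ #g.support := by positivity
    have h3 : ((2 * i - #g.support : ℝ) / n) ^ 2 ≤ 4 * ((i : ℝ) / n) ^ 2 := by
      rw [div_pow, div_pow, mul_div_assoc']
      refine div_le_div_of_nonneg_right ?_ (by positivity)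
      nlinarith
    have h4 := mul_le_mul_of_nonneg_left h3
      (by positivity : 0 ≤ ((#(cycles (Fin n) i) : ℝ) ^ 2)⁻¹ * (factorizations i g : ℝ) ^ 2)
    refine (le_of_eq ?_).trans (h4.trans_eq ?_)
    · ring
    · ring
  refine (sum_le_sum fun g _ => hpt g).trans ?_
  rw [← sum_filter, ← mul_sum, mul_assoc, inv_mul_le_iff₀ (by positivity)]
  refine (mul_le_mul_of_nonneg_left (sum_factorizations_sq_overlap_le_real hi hin)
    (by positivity)).trans_eq ?_
  field_simp

end Moments

lemma abs_sum_weight_mul_sub_gaussMean_le {i : ℕ} (hi : 2 ≤ i) (hin : i ≤ n) {ε K : ℝ}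
    (hε : 0 < ε) (hεn : ε ^ 2 = (n : ℝ)⁻¹) {h : ℝ → ℝ} (hc : Continuous h)
    (h01 : ∀ x, h x ∈ Set.Icc (0 : ℝ) 1) (hK : ∀ x y, |h y - h x| ≤ K * |y - x|) :
    |∑ l : Irr (Perm (Fin n)), l.weight * h (cycleStat n i l) - Stein.gaussMean h| ≤
      ε * (1 + (6 + K) * (16 * countBound i + 2)) := by
  have hn0 : n ≠ 0 := by omega
  have hn : (0 : ℝ) < n := by exact_mod_cast Nat.pos_of_ne_zero hn0
  have hi0 : (0 : ℝ) < i := by exact_mod_cast (by omega : 0 < i)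
  have ha : 0 < (i : ℝ) / n := div_pos hi0 hn
  have hR := countBound_nonneg i
  have hsum : ∑ l : Irr (Perm (Fin n)), l.weight = 1 := by
    have := sum_weight_mul_hat (fun g : Perm (Fin n) => if g = 1 then (1 : ℝ) else 0)
    simpa only [hat_indicator_one, mul_one, if_true] using this
  refine Stein.abs_sum_sub_gaussMean_le (p := kernel (fixedRatio n)) (V := hat (stepFun n i))
    ha hε (kernel_fixedRatio_nonneg hn0) (kernel_comm (isSymmClass_fixedRatio n).inv)
    (sum_kernel (fixedRatio_one n)) hsum sum_kernel_mul_cycleStat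
    (sum_kernel_mul_sq_sub hn0) ?_ ?_ ?_ ?_ hc h01 hK
  · simp only [sum_kernel_mul_sq_sub hn0]
    rw [sum_weight_mul_hat_stepFun hi hin]
    nlinarith [mul_nonneg hR ha.le]
  · rw [hεn]
    refine (sum_sum_kernel_mul_pow_four_sub_le hi hin).trans ?_
    gcongr
    linarith
  · simp only [← mul_assoc, ← sum_mul, sum_kernel_mul_sq_sub hn0]
    simp only [mul_assoc]
    refine (sum_weight_mul_hat_stepFun_mul_cycleStat_sq_le hi hin).trans ?_
    nlinarith [mul_nonneg hR ha.le]
  · rw [hεn]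
    refine (sum_weight_mul_sq_hat_stepFun_sub_le hi hin).trans ?_
    gcongr
    linarith

end Irr

end

/-! ### Conclusion: choice of the smoothing width. -/

theorem mainTheorem1 (i : ℕ) (hi : 2 ≤ i) :
    ∃ A : ℝ, ∀ (n : ℕ) (c : Equiv.Perm (Fin n)), c.IsCycle → c.support.card = i →
      ∀ x₀ : ℝ,
        |(Irr.plancherel (Equiv.Perm (Fin n))).real
              {l : Irr (Equiv.Perm (Fin n)) | Irr.cycleRatio i c l ≤ x₀}
            - (Real.sqrt (2 * Real.pi))⁻¹ * ∫ x in Set.Iic x₀, Real.exp (-x ^ 2 / 2)|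
          ≤ A * (n : ℝ) ^ (-(1 / 4) : ℝ) := by
  classical
  refine ⟨2 + 7 * (16 * Irr.countBound i + 2), fun n c hc hci x₀ => ?_⟩
  have hin : i ≤ n := by
    have := Finset.card_le_univ c.support
    rwa [hci, Fintype.card_fin] at this
  have hn1 : (1 : ℝ) ≤ n := by exact_mod_cast (by omega : 1 ≤ n)
  have hn : (0 : ℝ) < n := by linarith
  -- Stein's bound is applied with `ε = δ² = n^(-1/2)` and Lipschitz constant `δ⁻¹`, so its main
  -- term `ε δ⁻¹` equals the smoothing cost `δ`.
  set δ : ℝ := (n : ℝ) ^ (-(1 / 4) : ℝ) with hδ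
  have hδ0 : 0 < δ := Real.rpow_pos_of_pos hn _
  have hδ1 : δ ≤ 1 := Real.rpow_le_one_of_one_le_of_nonpos hn1 (by norm_num)
  have hδ4 : (δ ^ 2) ^ 2 = (n : ℝ)⁻¹ := by
    rw [← pow_mul, hδ, ← Real.rpow_natCast, ← Real.rpow_mul hn.le, ← Real.rpow_neg_one]
    norm_num
  rw [Irr.plancherel_real]
  simp only [Set.mem_ofPred_eq, Irr.cycleRatio_eq_cycleStat hi hc hci]
  have h := Stein.abs_sum_indicator_sub_le (P := Irr.weight) (W := Irr.cycleStat n i)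
    Irr.weight_nonneg hδ0 (fun h hcont h01 hK => Irr.abs_sum_weight_mul_sub_gaussMean_le hi hin
      (pow_pos hδ0 2) hδ4 hcont h01 hK) x₀
  refine h.trans ?_
  have hR := Irr.countBound_nonneg i
  have e1 : δ ^ 2 * δ⁻¹ = δ := by field_simp
  have e2 : δ ^ 2 ≤ δ := by nlinarith
  have e3 : δ ^ 2 * (1 + (6 + δ⁻¹) * (16 * Irr.countBound i + 2)) + δ =
      δ ^ 2 * (1 + 6 * (16 * Irr.countBound i + 2)) +
        δ ^ 2 * δ⁻¹ * (16 * Irr.countBound i + 2) + δ := by ring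
  rw [e3, e1]
  nlinarith [mul_le_mul_of_nonneg_right e2
    (by positivity : 0 ≤ 1 + 6 * (16 * Irr.countBound i + 2))]
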